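/- A \emph{convex disk} is a compact convex subset of $\mathbb{R}^2$ with non-empty interior. A \emph{tangent} to a convex disk $A$ is a line that intersects $A$ but not the interior of $A$, and $A$ is \emph{smooth} if every boundary point of $A$ lies on exactly one tangent to $A$. A \emph{homothet} of $A$ is a set of the form $\{r a+z : a\in A\}$ with $r>0$ and $z\in\mathbb{R}^2$. Let $G^{\mathrm{hom}}(A)$ be the class of intersection graphs of homothets of $A$, that is, of the finite simple graphs $G=(V,E)$ for which one can assign to each vertex $v\in V$ a homothet $R(v)$ of $A$ so that, for all distinct $u,v\in V$, $R(u)\cap R(v)\neq\emptyset$ if and only if $uv\in E$. Two sets $A,B\subseteq\mathbb{R}^2$ are \emph{affine equivalent} if some invertible affine transformation of $\mathbb{R}^2$ maps $A$ onto $B$. \textbf{Theorem.} Let $A$ and $B$ be smooth convex disks. Then $G^{\mathrm{hom}}(A)=G^{\mathrm{hom}}(B)$ if and only if $A$ and $B$ are affine equivalent. Moreover, if $A$ and $B$ are not affine equivalent, then neither $G^{\mathrm{hom}}(A)\subseteq G^{\mathrm{hom}}(B)$ nor $G^{\mathrm{hom}}(B)\subseteq G^{\mathrm{hom}}(A)$.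 -/

import Mathlib

/-- The Euclidean plane. -/
abbrev Plane : Type := EuclideanSpace ℝ (Fin 2)

/-- A convex disk: a compact convex subset of the plane with non-empty interior. -/
structure IsConvexDisk (A : Set Plane) : Prop where
  convex : Convex ℝ A
  isCompact : IsCompact A
  nonempty_interior : (interior A).Nonempty

/-- A tangent to `A`: a line (a one-dimensional affine subspace of the plane) that meets `A` but
not the interior of `A`. -/
structure IsTangentLine (A : Set Plane) (l : AffineSubspace ℝ Plane) : Prop where
  finrank_direction : Module.finrank ℝ l.direction = 1
  meets : ((l : Set Plane) ∩ A).Nonempty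
  disjoint_interior : Disjoint (l : Set Plane) (interior A)

/-- A smooth convex disk: each boundary point lies on exactly one tangent. -/
structure IsSmoothConvexDisk (A : Set Plane) : Prop extends IsConvexDisk A where
  existsUnique_tangent : ∀ p ∈ frontier A, ∃! l : AffineSubspace ℝ Plane,
    IsTangentLine A l ∧ p ∈ l

/-- `X` is a homothet of `A`: a positively scaled and translated copy of `A`. -/
def IsHomothet (A X : Set Plane) : Prop :=
  ∃ (r : ℝ) (z : Plane), 0 < r ∧ X = (fun a : Plane => r • a + z) '' A

/-- `R` is a realization of the graph `G` by members of the family `F` of subsets of the plane: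
two distinct vertices are adjacent exactly when the sets assigned to them intersect. -/
structure IsRealization {V : Type*} (G : SimpleGraph V) (F : Set (Set Plane))
    (R : V → Set Plane) : Prop where
  mem : ∀ v, R v ∈ F
  inter_nonempty_iff : ∀ u v, u ≠ v → ((R u ∩ R v).Nonempty ↔ G.Adj u v)

/-- The class of intersection graphs of homothets of `A`. Finite graphs are represented, up to
isomorphism, by the simple graphs on the vertex sets `Fin n`. -/
def homGraphs (A : Set Plane) : Set (Σ n : ℕ, SimpleGraph (Fin n)) :=
  {G | ∃ R : Fin G.1 → Set Plane, IsRealization G.2 {X | IsHomothet A X} R}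

/-- `A` and `B` are affine equivalent: an invertible affine transformation of the plane maps `A`
onto `B`. -/
def AffineEquivalent (A B : Set Plane) : Prop :=
  ∃ f : Plane ≃ᵃ[ℝ] Plane, f '' A = B

/-! Affine maps carry homothets to homothets, so only the implication from `homGraphs A ⊆ homGraphs
B` to affine equivalence needs work. A half-plane is a limit of ever larger homothets of a smooth
disk. Hence every finite pattern of homothets of `A`, points and half-planes, recorded by which
pairs meet and which are apart, can be copied with homothets of `B`.

The copy must be forced to treat half-planes as half-planes. Translates of the pattern are clustered
near three far apart points, many to a cluster, and the copy is rescaled so that the smallest image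
of the unit disk becomes `B`. If the cluster of that smallest image is strictly between the other
two in direction `v`, the images of its half-planes with normals `v` and `-v` meet many disjoint
sets of at least unit size, so by a packing bound they are huge
(`exists_isLocalRealization_medianNormals`). An ultrafilter combines all finite patterns, and these
half-planes become infinitely large.

Smoothness of `B` gives infinitely large sets unique limit normals, so no three of them near the
origin are pairwise disjoint (`MeetsBall.not_three_disjoint`). A disk between two such half-planes
therefore stays bounded, and a connectedness argument bounds the images of all points. Passing to
the limit yields a map `φ` of the plane taking the interior of `A` into `B` and the complement of
`A` outside the interior of `B`, and weakly monotone in each available direction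
(`IsLimitRealization.exists_isLimitMap`).

Monotonicity in directions `v₁`, `v₂`, `v₁ + v₂` makes the coordinates of `φ`, up to jumps, monotone
solutions of Pexider's equation. So `φ` is affine, and it maps `A` onto `B`
(`IsLimitMap.affineEquivalent`). -/

open Filter Topology

/-! ### Normalized disks, unique normals and invariance under affine maps -/

/-- The homothet of `B` with centre `z` and ratio `r`. -/
def homothet (B : Set Plane) (z : Plane) (r : ℝ) : Set Plane := (fun b : Plane => z + r • b) '' B

/-- A compact convex set containing the origin in its interior, with at most one unit inner normal
at each of its points. -/
structure IsNormalizedDisk (B : Set Plane) : Prop where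
  convex : Convex ℝ B
  isCompact : IsCompact B
  zero_mem_interior : (0 : Plane) ∈ interior B
  normal_unique : ∀ b ∈ B, ∀ u u' : Plane, ‖u‖ = 1 → ‖u'‖ = 1 →
    (∀ x ∈ B, 0 ≤ inner ℝ u (x - b)) → (∀ x ∈ B, 0 ≤ inner ℝ u' (x - b)) → u = u'

theorem inner_pos_of_mem_interior {B : Set Plane} {b u x : Plane} (hu : u ≠ 0)
    (h : ∀ x ∈ B, 0 ≤ inner ℝ u (x - b)) (hx : x ∈ interior B) : 0 < inner ℝ u (x - b) := by
  have hc : Filter.Tendsto (fun t : ℝ => x - t • u) (nhdsWithin 0 (Set.Ioi 0)) (nhds x) := by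
    have : Continuous (fun t : ℝ => x - t • u) := by fun_prop
    have := this.tendsto 0
    simp only [zero_smul, sub_zero] at this
    exact this.mono_left nhdsWithin_le_nhds
  have h1 := hc.eventually (mem_interior_iff_mem_nhds.mp hx)
  obtain ⟨t, ht, ht0⟩ := (h1.and self_mem_nhdsWithin).exists
  have h2 := h _ ht
  have : inner ℝ u (x - t • u - b) = inner ℝ u (x - b) - t * ‖u‖ ^ 2 := by
    rw [← real_inner_self_eq_norm_sq, sub_right_comm, inner_sub_right, inner_smul_right]
  rw [this] at h2
  have : 0 < t * ‖u‖ ^ 2 := mul_pos ht0 (by positivity)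
  linarith

theorem isTangentLine_of_inner_nonneg {A : Set Plane} {b u : Plane} (hu : u ≠ 0) (hb : b ∈ A)
    (h : ∀ x ∈ A, 0 ≤ inner ℝ u (x - b)) :
    IsTangentLine A (AffineSubspace.mk' b (Submodule.span ℝ {u})ᗮ) := by
  have : Fact (Module.finrank ℝ Plane = 1 + 1) := ⟨by simp⟩
  refine ⟨?_, ⟨b, AffineSubspace.self_mem_mk' _ _, hb⟩, ?_⟩
  · rw [AffineSubspace.direction_mk']
    exact Submodule.finrank_orthogonal_span_singleton hu
  · rw [Set.disjoint_left]
    intro x hx hxA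
    have h1 := inner_pos_of_mem_interior hu h hxA
    have h2 : x - b ∈ (Submodule.span ℝ {u})ᗮ := by
      simpa [AffineSubspace.mem_mk'] using hx
    rw [Submodule.mem_orthogonal_singleton_iff_inner_right] at h2
    exact h1.ne' h2

/-- Both normals define tangents through `b`, which coincide, so the normals are parallel. An
interior point of `A` lies strictly on the positive side of both, which fixes the sign. -/
theorem IsSmoothConvexDisk.normal_unique {A : Set Plane} (hA : IsSmoothConvexDisk A) {b u u' : Plane}
    (hb : b ∈ A) (hu : ‖u‖ = 1) (hu' : ‖u'‖ = 1)
    (h : ∀ x ∈ A, 0 ≤ inner ℝ u (x - b)) (h' : ∀ x ∈ A, 0 ≤ inner ℝ u' (x - b)) : u = u' := by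
  have hu0 : u ≠ 0 := by rintro rfl; simp at hu
  have hu0' : u' ≠ 0 := by rintro rfl; simp at hu'
  have hbf : b ∈ frontier A := by
    refine ⟨subset_closure hb, fun hbi => ?_⟩
    have := inner_pos_of_mem_interior hu0 h hbi
    simp at this
  have he := (hA.existsUnique_tangent b hbf).unique
    ⟨isTangentLine_of_inner_nonneg hu0 hb h, AffineSubspace.self_mem_mk' _ _⟩
    ⟨isTangentLine_of_inner_nonneg hu0' hb h', AffineSubspace.self_mem_mk' _ _⟩
  have hd := congrArg AffineSubspace.direction he
  rw [AffineSubspace.direction_mk', AffineSubspace.direction_mk'] at hd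
  have hd2 := congrArg Submodule.orthogonal hd
  rw [Submodule.orthogonal_orthogonal, Submodule.orthogonal_orthogonal] at hd2
  have hmem : u' ∈ Submodule.span ℝ {u} := hd2 ▸ Submodule.mem_span_singleton_self u'
  obtain ⟨t, rfl⟩ := Submodule.mem_span_singleton.mp hmem
  obtain ⟨x, hx⟩ := hA.nonempty_interior
  have h1 := inner_pos_of_mem_interior hu0 h hx
  have h2 := inner_pos_of_mem_interior hu0' h' hx
  rw [inner_smul_left] at h2
  simp only [conj_trivial] at h2
  have ht : 0 < t := by by_contra! hcon; nlinarith
  rw [norm_smul, hu, mul_one, Real.norm_eq_abs, abs_of_pos ht] at hu'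
  rw [hu', one_smul]

theorem IsSmoothConvexDisk.isNormalizedDisk_translate {A : Set Plane} (hA : IsSmoothConvexDisk A)
    {a : Plane} (ha : a ∈ interior A) : IsNormalizedDisk ((fun x => x - a) '' A) where
  convex := by
    have := hA.convex.translate (-a)
    have he : (fun z => -a + z) = (fun x : Plane => x - a) := by ext1 x; abel
    rwa [he] at this
  isCompact := hA.isCompact.image (by fun_prop)
  zero_mem_interior := by
    have := (Homeomorph.subRight a).image_interior A
    have h2 : (0 : Plane) ∈ (Homeomorph.subRight a) '' interior A := ⟨a, ha, by simp⟩
    rw [this] at h2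
    exact h2
  normal_unique := by
    rintro _ ⟨b, hb, rfl⟩ u u' hu hu' h h'
    refine hA.normal_unique hb hu hu' (fun x hx => ?_) (fun x hx => ?_)
    · simpa using h _ ⟨x, hx, rfl⟩
    · simpa using h' _ ⟨x, hx, rfl⟩

/-- The linear part commutes with scaling, so homothets go to homothets of the same ratio, and
injectivity preserves intersections. -/
theorem AffineEquivalent.homGraphs_subset {A B : Set Plane} (h : AffineEquivalent A B) :
    homGraphs A ⊆ homGraphs B := by
  obtain ⟨f, rfl⟩ := h
  rintro G ⟨R, hR⟩
  refine ⟨fun v => f '' R v, fun v => ?_, fun u v huv => ?_⟩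
  · obtain ⟨r, z, hr, he⟩ := hR.mem v
    refine ⟨r, f z - r • f.linear 0 - r • f 0, hr, ?_⟩
    have key : ∀ x, f x = f.linear x + f 0 := fun x => by
      have := f.map_vadd 0 x
      simpa using this
    show f '' R v = _
    rw [he, Set.image_image, Set.image_image]
    refine Set.image_congr fun a _ => ?_
    rw [key (r • a + z), key z, key a]
    simp only [map_add, map_smul, map_zero, smul_zero, smul_add]
    abel
  · rw [← hR.inter_nonempty_iff u v huv, ← Set.image_inter f.injective, Set.image_nonempty]

theorem AffineEquivalent.symm {A B : Set Plane} (h : AffineEquivalent A B) :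
    AffineEquivalent B A := by
  obtain ⟨f, rfl⟩ := h
  exact ⟨f.symm, by rw [Set.image_image]; simp⟩

theorem AffineEquivalent.trans {A B C : Set Plane} (h : AffineEquivalent A B)
    (h' : AffineEquivalent B C) : AffineEquivalent A C := by
  obtain ⟨f, rfl⟩ := h
  obtain ⟨g, rfl⟩ := h'
  exact ⟨f.trans g, by rw [Set.image_image]; simp⟩

theorem affineEquivalent_translate (A : Set Plane) (a : Plane) :
    AffineEquivalent A ((fun x => x - a) '' A) :=
  ⟨AffineEquiv.constVAdd ℝ Plane (-a), by
    refine Set.image_congr fun x _ => ?_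
    simp only [AffineEquiv.constVAdd_apply, vadd_eq_add]; abel⟩

/-! ### Homothets, the packing bound and tangent cones -/

theorem mem_homothet {B : Set Plane} {z x : Plane} {r : ℝ} :
    x ∈ homothet B z r ↔ ∃ b ∈ B, z + r • b = x := Iff.rfl

theorem norm_inv_norm_smul {v : Plane} (hv : v ≠ 0) : ‖‖v‖⁻¹ • v‖ = 1 := by
  rw [norm_smul, norm_inv, norm_norm, inv_mul_cancel₀ (norm_ne_zero_iff.mpr hv)]

theorem IsNormalizedDisk.zero_mem {B : Set Plane} (hB : IsNormalizedDisk B) : (0 : Plane) ∈ B :=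
  interior_subset hB.zero_mem_interior

theorem IsNormalizedDisk.exists_norm_le {B : Set Plane} (hB : IsNormalizedDisk B) :
    ∃ M : ℝ, 0 < M ∧ ∀ b ∈ B, ‖b‖ ≤ M := by
  obtain ⟨M, hM⟩ := hB.isCompact.isBounded.exists_norm_le
  exact ⟨max M 1, by positivity, fun b hb => (hM b hb).trans (le_max_left _ _)⟩

theorem IsNormalizedDisk.exists_ball_subset {B : Set Plane} (hB : IsNormalizedDisk B) :
    ∃ ρ : ℝ, 0 < ρ ∧ ∀ x : Plane, ‖x‖ < ρ → x ∈ B := by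
  obtain ⟨ρ, hρ, h⟩ := Metric.mem_nhds_iff.mp (mem_interior_iff_mem_nhds.mp hB.zero_mem_interior)
  exact ⟨ρ, hρ, fun x hx => h (by simpa using hx)⟩

/-- Among sufficiently many pairwise disjoint homothets meeting a given one, some are much smaller
than it. -/
theorem IsNormalizedDisk.exists_lt_of_pairwise_disjoint {B : Set Plane} (hB : IsNormalizedDisk B)
    {ε : ℝ} (hε : 0 < ε) : ∃ N : ℕ, ∀ (z : Fin N → Plane) (r : Fin N → ℝ) (y : Plane) (s : ℝ),
      0 < s → (∀ i, 0 < r i) →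
      (∀ i j, i ≠ j → Disjoint (homothet B (z i) (r i)) (homothet B (z j) (r j))) →
      (∀ i, (homothet B (z i) (r i) ∩ homothet B y s).Nonempty) → ∃ i, r i < ε * s := by
  obtain ⟨M, hM, hBM⟩ := hB.exists_norm_le
  obtain ⟨ρ, hρ, hBρ⟩ := hB.exists_ball_subset
  obtain ⟨T, -, hTf, hT⟩ := (isCompact_closedBall (0 : Plane) (M + ε * M)).finite_cover_balls
    (show 0 < ε * ρ / 2 by positivity)
  -- One more homothet than covering balls: by pigeonhole two of the vectors `c i - ε • b i`, built
  -- from the contact points with the given homothet, are closer than `ε * ρ`.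
  refine ⟨hTf.toFinset.card + 1, fun z r y s hs hr hd hm => ?_⟩
  by_contra! hcon
  have hex : ∀ i, ∃ b ∈ B, ∃ c ∈ B, z i + r i • b = y + s • c := fun i => by
    obtain ⟨x, ⟨b, hb, hbx⟩, ⟨c, hc, hcx⟩⟩ := hm i
    exact ⟨b, hb, c, hc, by rw [show z i + r i • b = x from hbx, show y + s • c = x from hcx]⟩
  choose b hb c hc he using hex
  have hmem : ∀ i, ∃ t ∈ T, c i - ε • b i ∈ Metric.ball t (ε * ρ / 2) := fun i => by
    have : c i - ε • b i ∈ Metric.closedBall (0 : Plane) (M + ε * M) := by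
      rw [mem_closedBall_zero_iff]
      calc ‖c i - ε • b i‖ ≤ ‖c i‖ + ‖ε • b i‖ := norm_sub_le _ _
        _ ≤ M + ε * M := by
          rw [norm_smul, Real.norm_of_nonneg hε.le]
          gcongr
          · exact hBM _ (hc i)
          · exact hBM _ (hb i)
    simpa using hT this
  choose t ht htb using hmem
  obtain ⟨i, j, hij, hteq⟩ := Fintype.exists_ne_map_eq_of_card_lt
    (fun i => (⟨t i, by simpa using ht i⟩ : hTf.toFinset)) (by simp)
  have hteq' : t i = t j := congrArg Subtype.val hteq
  have hdist : ‖(c i - ε • b i) - (c j - ε • b j)‖ < ε * ρ := by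
    rw [← dist_eq_norm]
    have h1 := htb i
    have h2 := htb j
    rw [Metric.mem_ball] at h1 h2
    rw [← hteq'] at h2
    have := dist_triangle_right (c i - ε • b i) (c j - ε • b j) (t i)
    linarith
  -- Shrinking each homothet about its contact point to ratio `ε * s` keeps it inside itself. Two
  -- shrunken copies with close centres overlap.
  have hsub : ∀ i, ∀ x ∈ B, y + s • (c i - ε • b i) + (ε * s) • x ∈ homothet B (z i) (r i) := by
    intro i x hx
    refine mem_homothet.mpr ⟨(1 - ε * s / r i) • b i + (ε * s / r i) • x, ?_, ?_⟩
    · refine hB.convex (hb i) hx ?_ (by have := hr i; positivity) (by ring)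
      have := (div_le_one (hr i)).mpr (hcon i)
      linarith
    · have hri := (hr i).ne'
      have h1 : r i • ((1 - ε * s / r i) • b i + (ε * s / r i) • x)
          = r i • b i - (ε * s) • b i + (ε * s) • x := by
        rw [smul_add, smul_smul, smul_smul, mul_div_cancel₀ _ hri, mul_sub, mul_one,
          mul_div_cancel₀ _ hri, sub_smul]
      rw [h1]
      have := he i
      have h2 : z i + (r i • b i - (ε * s) • b i + (ε * s) • x)
        = (z i + r i • b i) - (ε * s) • b i + (ε * s) • x := by abel
      rw [h2, this, smul_sub, smul_smul, mul_comm s ε]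
      abel
  refine Set.disjoint_left.mp (hd i j hij) (hsub i 0 hB.zero_mem) ?_
  have h3 := hsub j (ε⁻¹ • ((c i - ε • b i) - (c j - ε • b j))) (hBρ _ (by
    rw [norm_smul, norm_inv, Real.norm_of_nonneg hε.le, inv_mul_lt_iff₀ hε]; exact hdist))
  convert h3 using 1
  rw [smul_smul, show ε * s * ε⁻¹ = s by field_simp]
  module

theorem IsNormalizedDisk.exists_isMinOn_inner {A : Set Plane} (hA : IsNormalizedDisk A) (v : Plane) :
    ∃ a ∈ A, ∀ x ∈ A, 0 ≤ inner ℝ v (x - a) := by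
  obtain ⟨a, ha, h⟩ := hA.isCompact.exists_isMinOn ⟨0, hA.zero_mem⟩
    (f := fun x => inner ℝ v x) (by fun_prop)
  refine ⟨a, ha, fun x hx => ?_⟩
  have := h hx
  simp only [Set.mem_ofPred_eq] at this
  rw [inner_sub_right]; linarith

/-- At a boundary point with inner normal `v`, the tangent cone of the disk is a half-plane. -/
theorem IsNormalizedDisk.exists_add_smul_mem {A : Set Plane} (hA : IsNormalizedDisk A)
    {a v d : Plane} (ha : a ∈ A) (hv : v ≠ 0) (h : ∀ x ∈ A, 0 ≤ inner ℝ v (x - a))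
    (hd : 0 < inner ℝ v d) : ∃ t : ℝ, 0 < t ∧ a + t • d ∈ A := by
  -- If the ray misses `A`, a line separates it from the interior. Its normal is an inner normal at
  -- `a` with nonpositive product with `d`, unlike `v`, against uniqueness.
  by_contra! hcon
  have hray : Convex ℝ ((fun t : ℝ => a + t • d) '' Set.Ioi 0) := by
    have := (convex_Ioi (0 : ℝ)).is_linear_image
      (f := fun t : ℝ => t • d) ⟨fun x y => add_smul x y d, fun c x => mul_smul c x d⟩
    have h2 := this.translate a
    rwa [Set.image_image] at h2
  obtain ⟨f, u, hf1, hf2⟩ := geometric_hahn_banach_open hA.convex.interior isOpen_interior hray (by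
    rw [Set.disjoint_left]
    rintro _ hx ⟨t, ht, rfl⟩
    exact hcon t ht (interior_subset hx))
  have hle : ∀ x ∈ A, f x ≤ u := by
    intro x hx
    have hx' : x ∈ closure (interior A) := by
      rw [hA.convex.closure_interior_eq_closure_of_nonempty_interior ⟨0, hA.zero_mem_interior⟩]
      exact subset_closure hx
    have : closure (interior A) ⊆ {x | f x ≤ u} :=
      closure_minimal (fun y hy => (hf1 y hy).le) (isClosed_le f.continuous continuous_const)
    exact this hx'
  have hge : ∀ t : ℝ, 0 < t → u ≤ f a + t * f d := fun t ht => by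
    have := hf2 _ ⟨t, ht, rfl⟩
    simpa using this
  have hfa : u ≤ f a := by
    have hcont : Filter.Tendsto (fun t : ℝ => f a + t * f d) (nhdsWithin 0 (Set.Ioi 0))
        (nhds (f a)) := by
      have : Continuous (fun t : ℝ => f a + t * f d) := by fun_prop
      have := this.tendsto 0
      simp only [zero_mul, add_zero] at this
      exact this.mono_left nhdsWithin_le_nhds
    refine ge_of_tendsto hcont ?_
    filter_upwards [self_mem_nhdsWithin] with t ht using hge t ht
  have hfd : 0 ≤ f d := by
    have := hge 1 one_pos
    have := hle a ha
    linarith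
  set w : Plane := (InnerProductSpace.toDual ℝ Plane).symm (-f) with hw
  have hwf : ∀ x, inner ℝ w x = -f x := fun x => by
    rw [hw, InnerProductSpace.toDual_symm_apply]; rfl
  have hw0 : w ≠ 0 := by
    intro h0
    have h1 := hwf 0
    have h2 := hf1 0 hA.zero_mem_interior
    have h3 := hwf a
    rw [h0, inner_zero_left] at h3
    have h4 := hle a ha
    simp only [map_zero] at h2
    linarith
  have key := hA.normal_unique a ha (‖v‖⁻¹ • v) (‖w‖⁻¹ • w) (norm_inv_norm_smul hv)
    (norm_inv_norm_smul hw0)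
    (fun x hx => by rw [real_inner_smul_left]; exact mul_nonneg (by positivity) (h x hx))
    (fun x hx => by
      rw [real_inner_smul_left]
      refine mul_nonneg (by positivity) ?_
      rw [hwf, map_sub]
      have := hle x hx
      linarith)
  have h5 : inner ℝ (‖v‖⁻¹ • v) d = inner ℝ (‖w‖⁻¹ • w) d := by rw [key]
  rw [real_inner_smul_left, real_inner_smul_left, hwf] at h5
  have h6 : 0 < ‖v‖⁻¹ * inner ℝ v d := mul_pos (by positivity) hd
  have h7 : 0 ≤ ‖w‖⁻¹ * f d := mul_nonneg (by positivity) hfd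
  linarith

/-! ### Patterns of disks and half-planes, approximated by homothets -/

/-- A disk `z + r • A`, where `r = 0` gives the point `z`, or the half-plane `c ≤ ⟪v, x⟫`. -/
inductive PlaneObj : Type
  | disk (z : Plane) (r : NNReal)
  | half (v : Plane) (c : ℝ)

/-- Pairs of objects that meet, robustly so if one of them is a half-plane. -/
def PlaneObj.Meets (A : Set Plane) : PlaneObj → PlaneObj → Prop
  | disk z r, disk z' r' => (homothet A z r ∩ homothet A z' r').Nonempty
  | disk z r, half v c => v ≠ 0 ∧ ∃ x ∈ homothet A z r, c < inner ℝ v x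
  | _, _ => False

/-- Pairs of objects with positive distance. -/
def PlaneObj.Apart (A : Set Plane) : PlaneObj → PlaneObj → Prop
  | disk z r, disk z' r' => Disjoint (homothet A z r) (homothet A z' r')
  | disk z r, half v c => v ≠ 0 ∧ ∀ x ∈ homothet A z r, inner ℝ v x < c
  | half v c, half v' c' => v ≠ 0 ∧ v' = -v ∧ 0 < c + c'
  | _, _ => False

theorem IsNormalizedDisk.isCompact_homothet {A : Set Plane} (hA : IsNormalizedDisk A) (z : Plane)
    (r : ℝ) : IsCompact (homothet A z r) :=
  hA.isCompact.image (by fun_prop)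

theorem IsNormalizedDisk.convex_homothet {A : Set Plane} (hA : IsNormalizedDisk A) (z : Plane)
    (r : ℝ) : Convex ℝ (homothet A z r) := by
  have h := (hA.convex.smul r).translate z
  rwa [← Set.image_smul, Set.image_image] at h

theorem IsNormalizedDisk.homothet_subset {A : Set Plane} (hA : IsNormalizedDisk A) (z : Plane)
    {r s : ℝ} (hr : 0 ≤ r) (hrs : r ≤ s) : homothet A z r ⊆ homothet A z s := by
  rintro x ⟨a, ha, rfl⟩
  rcases hr.eq_or_lt with rfl | hr
  · exact ⟨0, hA.zero_mem, by simp⟩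
  · have hs : 0 < s := hr.trans_le hrs
    refine ⟨(r / s) • a, ?_, ?_⟩
    · exact hA.convex.smul_mem_of_zero_mem hA.zero_mem ha ⟨by positivity, (div_le_one hs).mpr hrs⟩
    · simp only [smul_smul]
      rw [mul_div_cancel₀ _ hs.ne']

theorem inner_smul_div_norm_sq {v : Plane} (hv : v ≠ 0) (c : ℝ) :
    inner ℝ v ((c / ‖v‖ ^ 2) • v) = c := by
  have : ‖v‖ ≠ 0 := norm_ne_zero_iff.mpr hv
  rw [real_inner_smul_right, real_inner_self_eq_norm_sq]
  field_simp

section Approximation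

variable {A : Set Plane} (hA : IsNormalizedDisk A)

/-- The homothet of `A` that approximates an object as `t` tends to `0` from the right. -/
noncomputable def PlaneObj.approx (t : ℝ) : PlaneObj → Plane × ℝ
  | disk z r => (z, r + t)
  -- The homothet of ratio `t⁻¹` inside the half-plane that touches the boundary line at the foot
  -- `(c / ‖v‖ ^ 2) • v` of the perpendicular from the origin.
  | half v c => ((c / ‖v‖ ^ 2) • v - t⁻¹ • (hA.exists_isMinOn_inner v).choose, t⁻¹)

/-- The set approximating an object. -/
noncomputable def PlaneObj.approxSet (t : ℝ) (o : PlaneObj) : Set Plane :=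
  homothet A (o.approx hA t).1 (o.approx hA t).2

theorem PlaneObj.approx_pos {t : ℝ} (ht : 0 < t) (o : PlaneObj) : 0 < (o.approx hA t).2 := by
  cases o with
  | disk z r => exact add_pos_of_nonneg_of_pos r.2 ht
  | half v c => exact inv_pos.mpr ht

theorem PlaneObj.le_inner_of_mem_approxSet {v : Plane} (hv : v ≠ 0) (c : ℝ) {t : ℝ} (ht : 0 < t)
    {x : Plane} (hx : x ∈ (half v c).approxSet hA t) : c ≤ inner ℝ v x := by
  obtain ⟨a, ha, rfl⟩ := hx
  have h := (hA.exists_isMinOn_inner v).choose_spec.2 a ha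
  simp only [approx]
  set a₀ := (hA.exists_isMinOn_inner v).choose
  rw [inner_add_right, inner_sub_right, inner_smul_div_norm_sq hv, real_inner_smul_right,
    real_inner_smul_right]
  rw [inner_sub_right] at h
  have := mul_nonneg (inv_pos.mpr ht).le h
  linarith

/-- Rescaling by `t` about the touching point asks for a short segment from the minimizer `a₀` in
the direction of `x` minus the foot to lie in `A`. That direction points strictly inward, so
smoothness of `A` provides it. -/
theorem PlaneObj.eventually_mem_approxSet {v : Plane} (hv : v ≠ 0) {c : ℝ} {x : Plane}
    (hx : c < inner ℝ v x) : ∀ᶠ t : ℝ in 𝓝[>] 0, x ∈ (half v c).approxSet hA t := by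
  obtain ⟨ha, h⟩ := (hA.exists_isMinOn_inner v).choose_spec
  set a₀ := (hA.exists_isMinOn_inner v).choose with ha₀
  obtain ⟨t₀, ht₀, hmem⟩ := hA.exists_add_smul_mem ha hv h
    (d := x - (c / ‖v‖ ^ 2) • v) (by
      rw [inner_sub_right, inner_smul_div_norm_sq hv]; linarith)
  filter_upwards [Ioo_mem_nhdsGT ht₀] with t ht
  refine mem_homothet.mpr ⟨a₀ + t • (x - (c / ‖v‖ ^ 2) • v), ?_, ?_⟩
  · have := hA.convex.add_smul_sub_mem ha hmem (t := t / t₀)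
      ⟨by have := ht.1; positivity, (div_le_one ht₀).mpr ht.2.le⟩
    rwa [add_sub_cancel_left, smul_smul, div_mul_cancel₀ _ ht₀.ne'] at this
  · simp only [approx, ← ha₀]
    rw [smul_add, smul_smul, inv_mul_cancel₀ ht.1.ne', one_smul]
    abel

theorem PlaneObj.homothet_subset_approxSet {t : ℝ} (ht : 0 < t) (z : Plane) (r : NNReal) :
    homothet A z r ⊆ (disk z r).approxSet hA t :=
  hA.homothet_subset z r.2 (by simp [approx, ht.le])

theorem PlaneObj.Meets.eventually {o o' : PlaneObj} (h : o.Meets A o') :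
    ∀ᶠ t : ℝ in 𝓝[>] 0, (o.approxSet hA t ∩ o'.approxSet hA t).Nonempty := by
  cases o with
  | half v c => exact h.elim
  | disk z r =>
    cases o' with
    | disk z' r' =>
      filter_upwards [self_mem_nhdsWithin] with t ht
      exact Set.Nonempty.mono (Set.inter_subset_inter (homothet_subset_approxSet hA ht z r)
        (homothet_subset_approxSet hA ht z' r')) h
    | half v c =>
      obtain ⟨hv, x, hx, hc⟩ := h
      filter_upwards [self_mem_nhdsWithin, eventually_mem_approxSet hA hv hc] with t ht hxt
      exact ⟨x, homothet_subset_approxSet hA ht z r hx, hxt⟩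

/-- Compactness leaves a gap that the enlargement of the disks, by at most `t * M`, does not close,
while the approximations of a half-plane never leave it. -/
theorem PlaneObj.Apart.eventually {o o' : PlaneObj} (h : o.Apart A o') :
    ∀ᶠ t : ℝ in 𝓝[>] 0, Disjoint (o.approxSet hA t) (o'.approxSet hA t) := by
  obtain ⟨M, hM, hAM⟩ := hA.exists_norm_le
  have hdec : ∀ (z : Plane) (r : NNReal) (t : ℝ), 0 < t → ∀ x ∈ (disk z r).approxSet hA t,
      ∃ y ∈ homothet A z r, ‖x - y‖ ≤ t * M := by
    rintro z r t ht _ ⟨a, ha, rfl⟩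
    refine ⟨z + (r : ℝ) • a, ⟨a, ha, rfl⟩, ?_⟩
    simp only [approx]
    rw [add_sub_add_left_eq_sub, ← sub_smul, add_sub_cancel_left, norm_smul,
      Real.norm_of_nonneg ht.le]
    exact mul_le_mul_of_nonneg_left (hAM a ha) ht.le
  cases o with
  | half v c =>
    cases o' with
    | disk z r => exact h.elim
    | half v' c' =>
      obtain ⟨hv, rfl, hc⟩ := h
      filter_upwards [self_mem_nhdsWithin] with t ht
      rw [Set.disjoint_left]
      intro x hx hx'
      have h1 := le_inner_of_mem_approxSet hA hv c ht hx
      have h2 := le_inner_of_mem_approxSet hA (neg_ne_zero.mpr hv) c' ht hx'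
      rw [inner_neg_left] at h2
      linarith
  | disk z r =>
    cases o' with
    | disk z' r' =>
      obtain ⟨δ, hδ, hsep⟩ := h.exists_thickenings (hA.isCompact_homothet z r)
        (hA.isCompact_homothet z' r').isClosed
      filter_upwards [Ioo_mem_nhdsGT (show 0 < δ / M by positivity)] with t ht
      refine hsep.mono ?_ ?_
      all_goals
        intro x hx
        obtain ⟨y, hy, hxy⟩ := hdec _ _ t ht.1 x hx
        refine Metric.mem_thickening_iff.mpr ⟨y, hy, ?_⟩
        rw [dist_eq_norm]
        exact hxy.trans_lt ((lt_div_iff₀ hM).mp ht.2)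
    | half v c =>
      obtain ⟨hv, hc⟩ := h
      obtain ⟨y₀, hy₀, hmax⟩ := (hA.isCompact_homothet z r).exists_isMaxOn
        ⟨z, 0, hA.zero_mem, by simp⟩ (f := fun x => inner ℝ v x) (by fun_prop)
      have hlt := hc y₀ hy₀
      have hvn : 0 < ‖v‖ := norm_pos_iff.mpr hv
      filter_upwards [Ioo_mem_nhdsGT
        (show 0 < (c - inner ℝ v y₀) / (‖v‖ * M) from div_pos (by linarith) (by positivity))]
        with t ht
      rw [Set.disjoint_left]
      intro x hx hx'
      have h1 := le_inner_of_mem_approxSet hA hv c ht.1 hx'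
      obtain ⟨y, hy, hxy⟩ := hdec _ _ t ht.1 x hx
      have h2 : inner ℝ v y ≤ inner ℝ v y₀ := hmax hy
      have h3 : inner ℝ v (x - y) ≤ ‖v‖ * (t * M) :=
        (real_inner_le_norm _ _).trans (mul_le_mul_of_nonneg_left hxy hvn.le)
      have h4 := (lt_div_iff₀ (by positivity)).mp ht.2
      rw [inner_sub_right] at h3
      nlinarith

end Approximation

/-- If `homGraphs A ⊆ homGraphs B`, then the pattern of any finite family of objects is realized by
homothets of `B`. -/
theorem exists_homothets_of_homGraphs_subset {A B : Set Plane} (hA : IsNormalizedDisk A)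
    (hAB : homGraphs A ⊆ homGraphs B) {ι : Type*} [Finite ι] (o : ι → PlaneObj) :
    ∃ ρ : ι → Plane × ℝ, (∀ i, 0 < (ρ i).2) ∧
      (∀ i j, i ≠ j → (o i).Meets A (o j) →
        (homothet B (ρ i).1 (ρ i).2 ∩ homothet B (ρ j).1 (ρ j).2).Nonempty) ∧
      (∀ i j, i ≠ j → (o i).Apart A (o j) →
        Disjoint (homothet B (ρ i).1 (ρ i).2) (homothet B (ρ j).1 (ρ j).2)) := by
  have hev : ∀ᶠ t : ℝ in 𝓝[>] 0, 0 < t ∧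
      (∀ i j, (o i).Meets A (o j) → ((o i).approxSet hA t ∩ (o j).approxSet hA t).Nonempty) ∧
      (∀ i j, (o i).Apart A (o j) → Disjoint ((o i).approxSet hA t) ((o j).approxSet hA t)) := by
    refine (eventually_mem_nhdsWithin).and (Eventually.and ?_ ?_)
    · refine eventually_all.mpr fun i => eventually_all.mpr fun j => eventually_imp_distrib_left.mpr
        fun h => h.eventually hA
    · refine eventually_all.mpr fun i => eventually_all.mpr fun j => eventually_imp_distrib_left.mpr
        fun h => h.eventually hA
  obtain ⟨t, ht, hmeet, hapart⟩ := hev.exists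
  obtain ⟨n, ⟨e⟩⟩ := Finite.exists_equiv_fin ι
  set R : Fin n → Set Plane := fun k => (o (e.symm k)).approxSet hA t with hR
  -- The intersection graph of the approximating sets themselves, so pairs that are neither `Meets`
  -- nor `Apart` need no attention.
  set G : SimpleGraph (Fin n) :=
    { Adj := fun u v => u ≠ v ∧ (R u ∩ R v).Nonempty
      symm := ⟨fun u v h => ⟨h.1.symm, by rw [Set.inter_comm]; exact h.2⟩⟩
      loopless := ⟨fun u h => h.1 rfl⟩ } with hG
  have hmem : (⟨n, G⟩ : Σ n : ℕ, SimpleGraph (Fin n)) ∈ homGraphs A := by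
    refine ⟨R, fun k => ?_, fun u v huv => ?_⟩
    · refine ⟨((o (e.symm k)).approx hA t).2, ((o (e.symm k)).approx hA t).1,
        PlaneObj.approx_pos hA ht _, ?_⟩
      exact Set.image_congr fun a _ => add_comm _ _
    · exact ⟨fun h => ⟨huv, h⟩, fun h => h.2⟩
  obtain ⟨R', hR'mem, hR'⟩ := hAB hmem
  choose r z hr hz using hR'mem
  have hz' : ∀ k, R' k = homothet B (z k) (r k) := fun k => by
    rw [hz k]; exact Set.image_congr fun a _ => add_comm _ _
  refine ⟨fun i => (z (e i), r (e i)), fun i => hr _, fun i j hij h => ?_, fun i j hij h => ?_⟩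
  · simp only [← hz']
    refine (hR' _ _ (e.injective.ne hij)).mpr ⟨e.injective.ne hij, ?_⟩
    simpa [hR] using hmeet i j h
  · simp only [← hz']
    rw [Set.disjoint_iff_inter_eq_empty, ← Set.not_nonempty_iff_eq_empty]
    rw [hR' _ _ (e.injective.ne hij)]
    rintro ⟨-, hne⟩
    rw [← Set.not_disjoint_iff_nonempty_inter] at hne
    exact hne (by simpa [hR] using hapart i j h)

/-! ### Local realizations in which half-planes are large -/

/-- Translation of an object. -/
noncomputable def PlaneObj.shift (w : Plane) : PlaneObj → PlaneObj
  | disk z r => disk (w + z) r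
  | half v c => half v (c + inner ℝ v w)

theorem homothet_add (A : Set Plane) (w z : Plane) (r : ℝ) :
    homothet A (w + z) r = (fun x => w + x) '' homothet A z r := by
  rw [homothet, homothet, Set.image_image]
  exact Set.image_congr fun a _ => add_assoc _ _ _

theorem PlaneObj.Meets.shift {A : Set Plane} {o o' : PlaneObj} (h : o.Meets A o') (w : Plane) :
    (o.shift w).Meets A (o'.shift w) := by
  cases o with
  | half v c => exact h.elim
  | disk z r =>
    cases o' with
    | disk z' r' =>
      show (homothet A (w + z) r ∩ homothet A (w + z') r').Nonempty
      rw [homothet_add, homothet_add, ← Set.image_inter (add_right_injective w)]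
      exact h.image _
    | half v c =>
      obtain ⟨hv, x, hx, hc⟩ := h
      refine ⟨hv, w + x, ?_, ?_⟩
      · rw [homothet_add]; exact ⟨x, hx, rfl⟩
      · rw [inner_add_right]; linarith

theorem PlaneObj.Apart.shift {A : Set Plane} {o o' : PlaneObj} (h : o.Apart A o') (w : Plane) :
    (o.shift w).Apart A (o'.shift w) := by
  cases o with
  | half v c =>
    cases o' with
    | disk z r => exact h.elim
    | half v' c' =>
      obtain ⟨hv, rfl, hc⟩ := h
      refine ⟨hv, rfl, ?_⟩
      rw [inner_neg_left]; linarith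
  | disk z r =>
    cases o' with
    | disk z' r' =>
      show Disjoint (homothet A (w + z) r) (homothet A (w + z') r')
      rw [homothet_add, homothet_add, Set.disjoint_image_iff (add_right_injective w)]
      exact h
    | half v c =>
      obtain ⟨hv, hc⟩ := h
      refine ⟨hv, ?_⟩
      rw [homothet_add]
      rintro _ ⟨x, hx, rfl⟩
      have := hc x hx
      rw [inner_add_right]; linarith

theorem homothet_smul_sub (B : Set Plane) (s : ℝ) (w z : Plane) (r : ℝ) :
    homothet B (s • (z - w)) (s * r) = (fun x => s • (x - w)) '' homothet B z r := by
  rw [homothet, homothet, Set.image_image]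
  refine Set.image_congr fun a _ => ?_
  rw [mul_smul, ← smul_add]
  congr 1; abel

/-- Normals for which the point `t j` lies strictly between two others of the points `t`. -/
def medianNormals (t : Fin 3 → Plane) (j : Fin 3) : Set Plane :=
  {v | (∃ l, inner ℝ v (t j) < inner ℝ v (t l)) ∧ ∃ l, inner ℝ v (t l) < inner ℝ v (t j)}

theorem neg_mem_medianNormals {t : Fin 3 → Plane} {j : Fin 3} {v : Plane}
    (hv : v ∈ medianNormals t j) : -v ∈ medianNormals t j := by
  obtain ⟨⟨l, hl⟩, l', hl'⟩ := hv
  exact ⟨⟨l', by simpa using hl'⟩, l, by simpa using hl⟩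

theorem ne_zero_of_mem_medianNormals {t : Fin 3 → Plane} {j : Fin 3} {v : Plane}
    (hv : v ∈ medianNormals t j) : v ≠ 0 := by
  rintro rfl
  obtain ⟨⟨l, hl⟩, -⟩ := hv
  simp at hl

/-- A realization by homothets of `B` of the pattern of the objects in `S`, normalized on the unit
disk, in which the half-planes with normals in `D` are large. -/
structure IsLocalRealization (A B : Set Plane) (D : Set Plane) (S : Finset PlaneObj) (n : ℕ)
    (ψ : PlaneObj → Plane × ℝ) : Prop where
  pos : ∀ o, 0 < (ψ o).2
  unit : ψ (.disk 0 1) = (0, 1)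
  meets : ∀ o ∈ S, ∀ o' ∈ S, o ≠ o' → o.Meets A o' →
    (homothet B (ψ o).1 (ψ o).2 ∩ homothet B (ψ o').1 (ψ o').2).Nonempty
  apart : ∀ o ∈ S, ∀ o' ∈ S, o ≠ o' → o.Apart A o' →
    Disjoint (homothet B (ψ o).1 (ψ o).2) (homothet B (ψ o').1 (ψ o').2)
  large : ∀ v ∈ D, ∀ c, .half v c ∈ S → n ≤ (ψ (.half v c)).2

theorem IsLocalRealization.mono {A B D : Set Plane} {S S' : Finset PlaneObj} {n n' : ℕ}
    {ψ : PlaneObj → Plane × ℝ} (h : IsLocalRealization A B D S n ψ) (hS : S' ⊆ S) (hn : n' ≤ n) :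
    IsLocalRealization A B D S' n' ψ where
  pos := h.pos
  unit := h.unit
  meets o ho o' ho' := h.meets o (hS ho) o' (hS ho')
  apart o ho o' ho' := h.apart o (hS ho) o' (hS ho')
  large v hv c hc := le_trans (by exact_mod_cast hn) (h.large v hv c (hS hc))

/-- Spread many translates of the pattern of `S` around the three points of `t`; in the copy whose
unit disk gets the smallest image, the half-planes with median normals meet many larger sets. -/
theorem exists_isLocalRealization_medianNormals {A B : Set Plane} (hA : IsNormalizedDisk A)
    (hB : IsNormalizedDisk B) (hAB : homGraphs A ⊆ homGraphs B) (t : Fin 3 → Plane)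
    (S : Finset PlaneObj) (n : ℕ) :
    ∃ j ψ, IsLocalRealization A B (medianNormals t j) S n ψ := by
  classical
  obtain ⟨M, hM, hAM⟩ := hA.exists_norm_le
  obtain ⟨N, hN⟩ := hB.exists_lt_of_pairwise_disjoint (ε := 1 / ((n : ℝ) + 1)) (by positivity)
  have hN0 : N ≠ 0 := by
    rintro rfl
    obtain ⟨i, -⟩ := hN (fun _ => 0) (fun _ => 0) 0 1 one_pos (fun i => i.elim0) (fun i => i.elim0)
      (fun i => i.elim0)
    exact i.elim0
  have : NeZero N := ⟨hN0⟩
  set Z : PlaneObj := .disk 0 1 with hZ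
  set S' : Finset PlaneObj := insert Z S with hS'
  set e : Plane := EuclideanSpace.single 0 1 with he
  have hen : ‖e‖ = 1 := by simp [he]
  -- Copy `(l, i)` sits in the cluster around `R • t l`; the step `2 * M + 1` exceeds the diameter
  -- of `A`, so unit disks of one cluster are disjoint. For large `R` the clusters are ordered as
  -- the points `t`, beyond any offset `c` in the pattern.
  set w : ℝ → Fin 3 × Fin N → Plane := fun R a =>
    R • t a.1 + ((a.2 : ℝ) * (2 * M + 1)) • e with hw
  have hfar : ∀ᶠ R : ℝ in atTop, ∀ (a b : Fin 3 × Fin N) (o : S') (v : Plane) (c : ℝ),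
      o.1 = .half v c → inner ℝ v (t a.1) < inner ℝ v (t b.1) →
      c + inner ℝ v (w R a) < inner ℝ v (w R b) := by
    refine eventually_all.mpr fun a => eventually_all.mpr fun b => eventually_all.mpr fun o => ?_
    rcases ho : o.1 with ⟨z, r⟩ | ⟨v, c⟩
    · exact Eventually.of_forall fun R v c h => by cases h
    · by_cases hlt : inner ℝ v (t a.1) < inner ℝ v (t b.1)
      · have hev := eventually_gt_atTop
          ((c + inner ℝ v (((a.2 : ℝ) * (2 * M + 1)) • e) -
            inner ℝ v (((b.2 : ℝ) * (2 * M + 1)) • e)) /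
            (inner ℝ v (t b.1) - inner ℝ v (t a.1)))
        filter_upwards [hev] with R hR v' c' h _
        cases h
        rw [div_lt_iff₀ (by linarith)] at hR
        simp only [hw]
        rw [inner_add_right, inner_add_right, real_inner_smul_right v (t a.1),
          real_inner_smul_right v (t b.1)]
        linarith
      · exact Eventually.of_forall fun R v' c' h h' => by cases h; exact (hlt h').elim
  obtain ⟨R, hR⟩ := hfar.exists
  obtain ⟨ρ, hρpos, hρmeet, hρapart⟩ := exists_homothets_of_homGraphs_subset hA hAB
    (fun p : (Fin 3 × Fin N) × S' => p.2.1.shift (w R p.1))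
  set ζ : S' := ⟨Z, Finset.mem_insert_self _ _⟩ with hζ
  -- The copy with the smallest image of the unit disk; it is rescaled to have that image equal to
  -- `B`.
  obtain ⟨a, ha⟩ := Finite.exists_min (fun a : Fin 3 × Fin N => (ρ (a, ζ)).2)
  have hpa := hρpos (a, ζ)
  set ra := (ρ (a, ζ)).2 with hra
  set za := (ρ (a, ζ)).1 with hza
  set ψ : PlaneObj → Plane × ℝ := fun o =>
    if h : o ∈ S' then (ra⁻¹ • ((ρ (a, ⟨o, h⟩)).1 - za), ra⁻¹ * (ρ (a, ⟨o, h⟩)).2) else (0, 1)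
    with hψ
  have hψS : ∀ o (h : o ∈ S'), homothet B (ψ o).1 (ψ o).2 =
      (fun x => ra⁻¹ • (x - za)) '' homothet B (ρ (a, ⟨o, h⟩)).1 (ρ (a, ⟨o, h⟩)).2 := fun o h => by
    rw [← homothet_smul_sub]
    simp only [hψ, dif_pos h]
  have hinj : Function.Injective (fun x : Plane => ra⁻¹ • (x - za)) := by
    intro x y h
    have := smul_right_injective Plane (inv_ne_zero hpa.ne') h
    exact sub_left_injective this
  have hSS' : ∀ o ∈ S, o ∈ S' := fun o ho => Finset.mem_insert_of_mem ho
  refine ⟨a.1, ψ, fun o => ?_, ?_, fun o ho o' ho' hne h => ?_, fun o ho o' ho' hne h => ?_,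
    fun v hv c hc => ?_⟩
  · simp only [hψ]
    split_ifs with h
    · exact mul_pos (inv_pos.mpr hpa) (hρpos _)
    · exact one_pos
  · have hmem : PlaneObj.disk 0 1 ∈ S' := Finset.mem_insert_self _ _
    simp only [hψ, dif_pos hmem]
    rw [Prod.mk.injEq]
    refine ⟨?_, inv_mul_cancel₀ hpa.ne'⟩
    show ra⁻¹ • (za - za) = 0
    rw [sub_self, smul_zero]
  · rw [hψS o (hSS' o ho), hψS o' (hSS' o' ho'), ← Set.image_inter hinj]
    refine Set.Nonempty.image _ (hρmeet _ _ ?_ (h.shift (w R a)))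
    simpa using hne
  · rw [hψS o (hSS' o ho), hψS o' (hSS' o' ho'), Set.disjoint_image_iff hinj]
    refine hρapart _ _ ?_ (h.shift (w R a))
    simpa using hne
  · have hcS := hSS' _ hc
    have hv0 := ne_zero_of_mem_medianNormals hv
    obtain ⟨⟨l, hl⟩, -⟩ := hv
    -- The `N` unit disks of a cluster further along `v` all meet this half-plane. One of their
    -- images has ratio below `1 / (n + 1)` times that of the half-plane, yet at least `ra`.
    obtain ⟨i, hi⟩ := hN (fun i => (ρ ((l, i), ζ)).1) (fun i => (ρ ((l, i), ζ)).2)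
      (ρ (a, ⟨_, hcS⟩)).1 (ρ (a, ⟨_, hcS⟩)).2 (hρpos _) (fun i => hρpos _) (fun i k hik => by
        refine hρapart ((l, i), ζ) ((l, k), ζ) (by simpa using hik) ?_
        show Disjoint (homothet A (w R (l, i) + 0) _) (homothet A (w R (l, k) + 0) _)
        rw [Set.disjoint_left]
        rintro _ ⟨x, hx, rfl⟩ ⟨y, hy, hxy⟩
        simp only [hw, add_zero, NNReal.coe_one, one_smul] at hxy
        have h1 : (((i : ℝ) - k) * (2 * M + 1)) • e = y - x := by
          have : (((i : ℝ) - k) * (2 * M + 1)) • e =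
            ((i : ℝ) * (2 * M + 1)) • e - ((k : ℝ) * (2 * M + 1)) • e := by
            rw [← sub_smul]; ring_nf
          rw [this]
          linear_combination (norm := module) (-1 : ℝ) • hxy
        have h2 : ‖y - x‖ ≤ 2 * M := by
          have := norm_sub_le y x
          have := hAM x hx
          have := hAM y hy
          linarith
        rw [← h1, norm_smul, hen, mul_one, norm_mul, Real.norm_of_nonneg (by positivity : 0 ≤ 2 * M + 1),
          Real.norm_eq_abs] at h2
        have h3 : (1 : ℝ) ≤ |(i : ℝ) - k| := by
          have h4 : ((i : ℕ) : ℤ) - (k : ℕ) ≠ 0 := by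
            intro h0
            exact hik (Fin.ext (by omega))
          have := Int.one_le_abs h4
          exact_mod_cast this
        nlinarith) (fun i => by
        refine hρmeet ((l, i), ζ) (a, ⟨_, hcS⟩) (by simp [hζ, hZ]) ?_
        refine ⟨hv0, w R (l, i), ⟨0, hA.zero_mem, by simp⟩, ?_⟩
        exact hR a (l, i) ⟨_, hcS⟩ v c rfl hl)
    have h1 := (ha (l, i)).trans_lt hi
    have hn : (0 : ℝ) < (n : ℝ) + 1 := by positivity
    simp only [hψ, dif_pos hcS]
    rw [one_div, ← div_eq_inv_mul, lt_div_iff₀ hn] at h1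
    rw [← div_eq_inv_mul, le_div_iff₀ hpa]
    nlinarith

/-- There is a set `D` of normals, closed under negation, that contains two linearly independent
normals together with their sum and for which all local realizations exist. -/
theorem exists_isLocalRealization {A B : Set Plane} (hA : IsNormalizedDisk A)
    (hB : IsNormalizedDisk B) (hAB : homGraphs A ⊆ homGraphs B) :
    ∃ D : Set Plane, (∀ v ∈ D, v ≠ 0) ∧ (∀ v ∈ D, -v ∈ D) ∧
      (∃ v₁ ∈ D, ∃ v₂ ∈ D, v₁ + v₂ ∈ D ∧ v₁ 0 * v₂ 1 - v₁ 1 * v₂ 0 ≠ 0) ∧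
      ∀ (S : Finset PlaneObj) (n : ℕ), ∃ ψ, IsLocalRealization A B D S n ψ := by
  classical
  set t : Fin 3 → Plane := ![0, !₂[1, 0], !₂[0, 1]] with ht
  obtain ⟨j, hj⟩ : ∃ j, ∀ (S : Finset PlaneObj) (n : ℕ),
      ∃ ψ, IsLocalRealization A B (medianNormals t j) S n ψ := by
    -- If every `j` failed for some pair, the union of the three patterns with the largest of the
    -- three bounds would fail for every `j`.
    by_contra! hcon
    choose S n h using hcon
    obtain ⟨j, ψ, hψ⟩ := exists_isLocalRealization_medianNormals hA hB hAB t
      (Finset.univ.biUnion S) (Finset.univ.sup n)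
    exact h j ψ (hψ.mono (Finset.subset_biUnion_of_mem S (Finset.mem_univ j))
      (Finset.le_sup (Finset.mem_univ j)))
  refine ⟨medianNormals t j, fun v hv => ne_zero_of_mem_medianNormals hv,
    fun v hv => neg_mem_medianNormals hv, ?_, hj⟩
  have hmem : ∀ v : Plane, (∃ l l', inner ℝ v (t j) < inner ℝ v (t l) ∧
      inner ℝ v (t l') < inner ℝ v (t j)) → v ∈ medianNormals t j :=
    fun v ⟨l, l', h, h'⟩ => ⟨⟨l, h⟩, l', h'⟩
  have h0 : t 0 = 0 := rfl
  have h1 : t 1 = !₂[1, 0] := rfl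
  have h2 : t 2 = !₂[0, 1] := rfl
  obtain rfl | rfl | rfl : j = 0 ∨ j = 1 ∨ j = 2 := by fin_cases j <;> simp
  · refine ⟨!₂[1, -2], hmem _ ⟨1, 2, ?_⟩, !₂[2, -1], hmem _ ⟨1, 2, ?_⟩, hmem _ ⟨1, 2, ?_⟩, ?_⟩
    all_goals norm_num [h0, h1, h2, PiLp.inner_apply, Fin.sum_univ_two]
  · refine ⟨!₂[1, 2], hmem _ ⟨2, 0, ?_⟩, !₂[1, 3], hmem _ ⟨2, 0, ?_⟩, hmem _ ⟨2, 0, ?_⟩, ?_⟩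
    all_goals norm_num [h0, h1, h2, PiLp.inner_apply, Fin.sum_univ_two]
  · refine ⟨!₂[2, 1], hmem _ ⟨1, 0, ?_⟩, !₂[3, 1], hmem _ ⟨1, 0, ?_⟩, hmem _ ⟨1, 0, ?_⟩, ?_⟩
    all_goals norm_num [h0, h1, h2, PiLp.inner_apply, Fin.sum_univ_two]

/-! ### Families of homothets along an ultrafilter -/

theorem ne_neg_of_ne_zero {v : Plane} (hv : v ≠ 0) : v ≠ -v := by
  intro h
  rw [eq_neg_iff_add_eq_zero, ← two_smul ℝ] at h
  exact hv ((smul_eq_zero.mp h).resolve_left two_ne_zero)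

section Families

variable {Ω : Type*} (B : Set Plane) (U : Ultrafilter Ω)

/-- The homothets of `B` with parameters `X` eventually meet a fixed ball. -/
def MeetsBall (X : Ω → Plane × ℝ) : Prop :=
  ∃ R : ℝ, ∀ᶠ σ in U, ∃ b ∈ B, ‖(X σ).1 + (X σ).2 • b‖ ≤ R

/-- The parameters `X` are eventually bounded. -/
def EventuallyBounded (X : Ω → Plane × ℝ) : Prop :=
  ∃ R : ℝ, ∀ᶠ σ in U, ‖(X σ).1‖ ≤ R ∧ (X σ).2 ≤ R

/-- The homothets with parameters `X` become infinitely large and meet a fixed ball in points that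
correspond, in the limit, to the point `b` of `B`. -/
def Contact (X : Ω → Plane × ℝ) (b : Plane) : Prop :=
  Tendsto (fun σ => (X σ).2) U atTop ∧ ∃ (R : ℝ) (β : Ω → Plane),
    (∀ᶠ σ in U, β σ ∈ B ∧ ‖(X σ).1 + (X σ).2 • β σ‖ ≤ R) ∧ Tendsto β U (𝓝 b)

/-- `u` is a unit inner normal of `B` at `b`. -/
def IsInnerNormal (b u : Plane) : Prop := ‖u‖ = 1 ∧ ∀ x ∈ B, 0 ≤ inner ℝ u (x - b)

end Families

section

variable {Ω : Type*} {B : Set Plane} {U : Ultrafilter Ω} {X Y W : Ω → Plane × ℝ} {b b' u u' : Plane}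

theorem Ultrafilter.exists_tendsto_of_norm_le {E : Type*} [NormedAddCommGroup E] [ProperSpace E]
    {f : Ω → E} {R : ℝ} (h : ∀ᶠ σ in (U : Filter Ω), ‖f σ‖ ≤ R) : ∃ x, Tendsto f U (𝓝 x) := by
  obtain ⟨x, -, hx⟩ := (isCompact_closedBall (0 : E) R).ultrafilter_le_nhds (U.map f) (by
    rw [Ultrafilter.coe_map, le_principal_iff, Filter.mem_map]
    filter_upwards [h] with σ hσ
    simpa using hσ)
  exact ⟨x, hx⟩

theorem Ultrafilter.tendsto_atTop_of_not_bounded {f : Ω → ℝ}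
    (h : ¬ ∃ R, ∀ᶠ σ in (U : Filter Ω), f σ ≤ R) : Tendsto f U atTop := by
  rw [tendsto_atTop]
  intro R
  have : ∀ᶠ σ in (U : Filter Ω), ¬ f σ ≤ R := Ultrafilter.eventually_not.mpr fun hc => h ⟨R, hc⟩
  filter_upwards [this] with σ hσ using (not_le.mp hσ).le

theorem MeetsBall.of_meets (hB : IsNormalizedDisk B) (hpos : ∀ σ, 0 < (Y σ).2)
    (hY : EventuallyBounded U Y)
    (h : ∀ᶠ σ in (U : Filter Ω), (homothet B (X σ).1 (X σ).2 ∩ homothet B (Y σ).1 (Y σ).2).Nonempty) :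
    MeetsBall B U X := by
  obtain ⟨M, hM, hBM⟩ := hB.exists_norm_le
  obtain ⟨R, hR⟩ := hY
  refine ⟨R + R * M, ?_⟩
  filter_upwards [hR, h] with σ hσ hm
  obtain ⟨x, ⟨b, hb, rfl⟩, ⟨c, hc, hcx⟩⟩ := hm
  refine ⟨b, hb, ?_⟩
  rw [← show (Y σ).1 + (Y σ).2 • c = (X σ).1 + (X σ).2 • b from hcx]
  refine (norm_add_le _ _).trans (add_le_add hσ.1 ?_)
  rw [norm_smul, Real.norm_of_nonneg (hpos σ).le]
  exact mul_le_mul hσ.2 (hBM c hc) (norm_nonneg _) ((hpos σ).le.trans hσ.2)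

theorem EventuallyBounded.meetsBall (hB : IsNormalizedDisk B) (hX : EventuallyBounded U X) :
    MeetsBall B U X := by
  obtain ⟨R, hR⟩ := hX
  refine ⟨R, ?_⟩
  filter_upwards [hR] with σ hσ
  exact ⟨0, hB.zero_mem, by simpa using hσ.1⟩

theorem MeetsBall.exists_contact (hB : IsNormalizedDisk B) (hX : MeetsBall B U X)
    (hr : Tendsto (fun σ => (X σ).2) U atTop) : ∃ b ∈ B, Contact B U X b := by
  obtain ⟨R, hR⟩ := hX
  have hex : ∀ σ, ∃ β : Plane, (∃ b ∈ B, ‖(X σ).1 + (X σ).2 • b‖ ≤ R) →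
      β ∈ B ∧ ‖(X σ).1 + (X σ).2 • β‖ ≤ R := fun σ => by
    by_cases h : ∃ b ∈ B, ‖(X σ).1 + (X σ).2 • b‖ ≤ R
    · exact ⟨h.choose, fun _ => h.choose_spec⟩
    · exact ⟨0, fun h' => (h h').elim⟩
  choose β hβ using hex
  have hev : ∀ᶠ σ in (U : Filter Ω), β σ ∈ B ∧ ‖(X σ).1 + (X σ).2 • β σ‖ ≤ R := by
    filter_upwards [hR] with σ hσ using hβ σ hσ
  obtain ⟨b, hb, hlim⟩ := hB.isCompact.ultrafilter_le_nhds (U.map β) (by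
    rw [Ultrafilter.coe_map, le_principal_iff, Filter.mem_map]
    filter_upwards [hev] with σ hσ using hσ.1)
  exact ⟨b, hb, hr, R, β, hev, hlim⟩

/-- Along an ultrafilter the ratios are bounded or tend to infinity. If bounded, a point near the
origin keeps the centres bounded too. -/
theorem MeetsBall.eventuallyBounded_or (hB : IsNormalizedDisk B) (hpos : ∀ σ, 0 < (X σ).2)
    (hX : MeetsBall B U X) :
    EventuallyBounded U X ∨ Tendsto (fun σ => (X σ).2) U atTop := by
  by_cases h : ∃ R, ∀ᶠ σ in (U : Filter Ω), (X σ).2 ≤ R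
  · left
    obtain ⟨M, hM, hBM⟩ := hB.exists_norm_le
    obtain ⟨R, hR⟩ := h
    obtain ⟨R', hR'⟩ := hX
    refine ⟨max R (R' + R * M), ?_⟩
    filter_upwards [hR, hR'] with σ hσ ⟨b, hb, hσ'⟩
    refine ⟨le_trans ?_ (le_max_right _ _), hσ.trans (le_max_left _ _)⟩
    have h1 : (X σ).1 = ((X σ).1 + (X σ).2 • b) - (X σ).2 • b := by abel
    rw [h1]
    refine (norm_sub_le _ _).trans (add_le_add hσ' ?_)
    rw [norm_smul, Real.norm_of_nonneg (hpos σ).le]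
    exact mul_le_mul hσ (hBM b hb) (norm_nonneg _) ((hpos σ).le.trans hσ)
  · exact Or.inr (Ultrafilter.tendsto_atTop_of_not_bounded h)

/-- Disjoint families of homothets that stay near the origin are separated by convergent lines. -/
theorem exists_tendsto_separation (hB : IsNormalizedDisk B) (hX : MeetsBall B U X)
    (hY : MeetsBall B U Y) (hd : ∀ᶠ σ in (U : Filter Ω),
      Disjoint (homothet B (X σ).1 (X σ).2) (homothet B (Y σ).1 (Y σ).2)) :
    ∃ (ν : Ω → Plane) (g : Ω → ℝ) (u : Plane) (γ : ℝ), ‖u‖ = 1 ∧ Tendsto ν U (𝓝 u) ∧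
      Tendsto g U (𝓝 γ) ∧ (∀ᶠ σ in (U : Filter Ω), ∀ b ∈ B,
        g σ ≤ inner ℝ (ν σ) ((X σ).1 + (X σ).2 • b)) ∧
      (∀ᶠ σ in (U : Filter Ω), ∀ b ∈ B, inner ℝ (ν σ) ((Y σ).1 + (Y σ).2 • b) ≤ g σ) := by
  have hex : ∀ σ, ∃ (v : Plane) (c : ℝ),
      Disjoint (homothet B (X σ).1 (X σ).2) (homothet B (Y σ).1 (Y σ).2) →
      ‖v‖ = 1 ∧ (∀ b ∈ B, c ≤ inner ℝ v ((X σ).1 + (X σ).2 • b)) ∧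
        ∀ b ∈ B, inner ℝ v ((Y σ).1 + (Y σ).2 • b) ≤ c := by
    intro σ
    by_cases h : Disjoint (homothet B (X σ).1 (X σ).2) (homothet B (Y σ).1 (Y σ).2)
    · obtain ⟨f, c, c', h1, h2, h3⟩ := geometric_hahn_banach_compact_closed
        (hB.convex_homothet _ _) (hB.isCompact_homothet _ _) (hB.convex_homothet _ _)
        (hB.isCompact_homothet _ _).isClosed h.symm
      set w : Plane := (InnerProductSpace.toDual ℝ Plane).symm f with hw
      have hwf : ∀ x, inner ℝ w x = f x := fun x => by
        rw [hw, InnerProductSpace.toDual_symm_apply]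
      have hw0 : w ≠ 0 := by
        intro h0
        have e1 := h1 _ (mem_homothet.mpr ⟨0, hB.zero_mem, rfl⟩)
        have e2 := h3 _ (mem_homothet.mpr ⟨0, hB.zero_mem, rfl⟩)
        rw [← hwf, h0, inner_zero_left] at e1 e2
        linarith
      have hwn : 0 ≤ ‖w‖⁻¹ := by positivity
      refine ⟨‖w‖⁻¹ • w, ‖w‖⁻¹ * c, fun _ => ⟨norm_inv_norm_smul hw0, fun b hb => ?_,
        fun b hb => ?_⟩⟩
      · rw [real_inner_smul_left, hwf]
        exact mul_le_mul_of_nonneg_left (h2.trans (h3 _ (mem_homothet.mpr ⟨b, hb, rfl⟩))).le hwn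
      · rw [real_inner_smul_left, hwf]
        exact mul_le_mul_of_nonneg_left (h1 _ (mem_homothet.mpr ⟨b, hb, rfl⟩)).le hwn
    · exact ⟨0, 0, fun h' => (h h').elim⟩
  choose ν g hνg using hex
  have hev : ∀ᶠ σ in (U : Filter Ω), ‖ν σ‖ = 1 ∧
      (∀ b ∈ B, g σ ≤ inner ℝ (ν σ) ((X σ).1 + (X σ).2 • b)) ∧
        ∀ b ∈ B, inner ℝ (ν σ) ((Y σ).1 + (Y σ).2 • b) ≤ g σ := by
    filter_upwards [hd] with σ hσ using hνg σ hσ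
  obtain ⟨R, hR⟩ := hX
  obtain ⟨R', hR'⟩ := hY
  obtain ⟨u, hu⟩ := Ultrafilter.exists_tendsto_of_norm_le (U := U) (f := ν) (R := 1) (by
    filter_upwards [hev] with σ hσ using hσ.1.le)
  -- The offsets are bounded because both sets have points near the origin, on either side of the
  -- separating line.
  obtain ⟨γ, hγ⟩ := Ultrafilter.exists_tendsto_of_norm_le (U := U) (f := g) (R := max R R') (by
    filter_upwards [hev, hR, hR'] with σ hσ ⟨b, hb, hbR⟩ ⟨b', hb', hbR'⟩
    rw [Real.norm_eq_abs, abs_le]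
    have h1 := hσ.2.1 b hb
    have h2 := hσ.2.2 b' hb'
    have h3 := abs_le.mp (abs_real_inner_le_norm (ν σ) ((X σ).1 + (X σ).2 • b))
    have h4 := abs_le.mp (abs_real_inner_le_norm (ν σ) ((Y σ).1 + (Y σ).2 • b'))
    rw [hσ.1, one_mul] at h3 h4
    exact ⟨by linarith [le_max_right R R'], by linarith [le_max_left R R']⟩)
  refine ⟨ν, g, u, γ, ?_, hu, hγ, ?_, ?_⟩
  · refine tendsto_nhds_unique hu.norm (tendsto_const_nhds.congr' ?_)
    filter_upwards [hev] with σ hσ using hσ.1.symm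
  · filter_upwards [hev] with σ hσ using hσ.2.1
  · filter_upwards [hev] with σ hσ using hσ.2.2

/-- The contact point is near the origin, so dividing the inequality by the ratio bounds `⟪ν, x -
β⟫` below by a quantity tending to zero. -/
theorem Contact.isInnerNormal (hX : Contact B U X b) {ν : Ω → Plane} {g : Ω → ℝ} {γ : ℝ}
    (hu : ‖u‖ = 1) (hν : Tendsto ν U (𝓝 u)) (hg : Tendsto g U (𝓝 γ))
    (h : ∀ᶠ σ in (U : Filter Ω), ∀ b ∈ B, g σ ≤ inner ℝ (ν σ) ((X σ).1 + (X σ).2 • b)) :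
    IsInnerNormal B b u := by
  refine ⟨hu, fun x hx => ?_⟩
  obtain ⟨hr, R, β, hβ, hβb⟩ := hX
  have hlim : Tendsto (fun σ => inner ℝ (ν σ) (x - β σ)) U (𝓝 (inner ℝ u (x - b))) :=
    hν.inner (tendsto_const_nhds.sub hβb)
  have hlow : Tendsto (fun σ => (g σ - ‖ν σ‖ * R) / (X σ).2) U (𝓝 0) :=
    (hg.sub (hν.norm.mul_const R)).div_atTop hr
  refine le_of_tendsto_of_tendsto hlow hlim ?_
  filter_upwards [h, hβ, hr.eventually_gt_atTop 0] with σ h1 h2 h3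
  rw [div_le_iff₀ h3]
  have h4 := h1 x hx
  have h5 : inner ℝ (ν σ) ((X σ).1 + (X σ).2 • β σ) ≤ ‖ν σ‖ * R :=
    (real_inner_le_norm _ _).trans (mul_le_mul_of_nonneg_left h2.2 (norm_nonneg _))
  rw [inner_add_right, real_inner_smul_right] at h4 h5
  rw [inner_sub_right]
  linarith

theorem IsInnerNormal.unique (hB : IsNormalizedDisk B) (hb : b ∈ B) (h : IsInnerNormal B b u)
    (h' : IsInnerNormal B b u') : u = u' :=
  hB.normal_unique b hb u u' h.1 h'.1 h.2 h'.2

theorem Contact.meetsBall (hX : Contact B U X b) : MeetsBall B U X := by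
  obtain ⟨-, R, β, hβ, -⟩ := hX
  exact ⟨R, by filter_upwards [hβ] with σ hσ using ⟨β σ, hσ⟩⟩

/-- Disjoint families of infinitely large homothets have opposite normals. -/
theorem Contact.exists_isInnerNormal_neg (hB : IsNormalizedDisk B) (hX : Contact B U X b)
    (hY : Contact B U Y b') (hd : ∀ᶠ σ in (U : Filter Ω),
      Disjoint (homothet B (X σ).1 (X σ).2) (homothet B (Y σ).1 (Y σ).2)) :
    ∃ u, IsInnerNormal B b u ∧ IsInnerNormal B b' (-u) := by
  obtain ⟨ν, g, u, γ, hu, hν, hg, h1, h2⟩ :=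
    exists_tendsto_separation hB hX.meetsBall hY.meetsBall hd
  refine ⟨u, hX.isInnerNormal hu hν hg h1, hY.isInnerNormal (by rwa [norm_neg]) hν.neg hg.neg ?_⟩
  filter_upwards [h2] with σ hσ c hc
  rw [inner_neg_left]
  exact neg_le_neg (hσ c hc)

/-- There are no three disjoint families of infinitely large homothets near the origin. -/
theorem MeetsBall.not_three_disjoint (hB : IsNormalizedDisk B) (hX : MeetsBall B U X)
    (hY : MeetsBall B U Y) (hW : MeetsBall B U W) (hrX : Tendsto (fun σ => (X σ).2) U atTop)
    (hrY : Tendsto (fun σ => (Y σ).2) U atTop) (hrW : Tendsto (fun σ => (W σ).2) U atTop)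
    (hXY : ∀ᶠ σ in (U : Filter Ω),
      Disjoint (homothet B (X σ).1 (X σ).2) (homothet B (Y σ).1 (Y σ).2))
    (hXW : ∀ᶠ σ in (U : Filter Ω),
      Disjoint (homothet B (X σ).1 (X σ).2) (homothet B (W σ).1 (W σ).2))
    (hYW : ∀ᶠ σ in (U : Filter Ω),
      Disjoint (homothet B (Y σ).1 (Y σ).2) (homothet B (W σ).1 (W σ).2)) : False := by
  obtain ⟨b, hb, hcX⟩ := hX.exists_contact hB hrX
  obtain ⟨b', hb', hcY⟩ := hY.exists_contact hB hrY
  obtain ⟨b'', hb'', hcW⟩ := hW.exists_contact hB hrW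
  obtain ⟨u, hu, hu'⟩ := hcX.exists_isInnerNormal_neg hB hcY hXY
  obtain ⟨v, hv, hv'⟩ := hcX.exists_isInnerNormal_neg hB hcW hXW
  obtain ⟨w, hw, hw'⟩ := hcY.exists_isInnerNormal_neg hB hcW hYW
  -- With `u` the normal of `X`, both others have normal `-u`; being disjoint from each other they
  -- would also have opposite normals.
  obtain rfl := hu.unique hB hb hv
  obtain rfl := hw.unique hB hb' hu'
  have h := hw'.unique hB hb'' hv'
  rw [neg_neg] at h
  refine ne_neg_of_ne_zero ?_ h
  rintro rfl
  simpa using hu.1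

end

/-! ### Limit realizations and boundedness of all points -/

/-- A family of parameters of homothets of `B` that, along an ultrafilter, realizes the pattern of
all objects, with half-planes with normals in `D` becoming infinitely large. -/
structure IsLimitRealization (A B D : Set Plane) {Ω : Type*} (U : Ultrafilter Ω)
    (ψ : PlaneObj → Ω → Plane × ℝ) : Prop where
  pos : ∀ o σ, 0 < (ψ o σ).2
  unit : ∀ σ, ψ (.disk 0 1) σ = (0, 1)
  meets : ∀ o o', o ≠ o' → o.Meets A o' → ∀ᶠ σ in (U : Filter Ω),
    (homothet B (ψ o σ).1 (ψ o σ).2 ∩ homothet B (ψ o' σ).1 (ψ o' σ).2).Nonempty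
  apart : ∀ o o', o ≠ o' → o.Apart A o' → ∀ᶠ σ in (U : Filter Ω),
    Disjoint (homothet B (ψ o σ).1 (ψ o σ).2) (homothet B (ψ o' σ).1 (ψ o' σ).2)
  large : ∀ v ∈ D, ∀ c, Tendsto (fun σ => (ψ (.half v c) σ).2) U atTop
  ne_zero : ∀ v ∈ D, v ≠ 0
  neg_mem : ∀ v ∈ D, -v ∈ D

/-- For an ultrafilter finer than `atTop` on pairs of a finite pattern and a size bound, each object
eventually belongs to the pattern and each bound is eventually exceeded. -/
theorem exists_isLimitRealization {A B : Set Plane} (hA : IsNormalizedDisk A)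
    (hB : IsNormalizedDisk B) (hAB : homGraphs A ⊆ homGraphs B) :
    ∃ (D : Set Plane) (U : Ultrafilter (Finset PlaneObj × ℕ))
      (ψ : PlaneObj → Finset PlaneObj × ℕ → Plane × ℝ), IsLimitRealization A B D U ψ ∧
      ∃ v₁ ∈ D, ∃ v₂ ∈ D, v₁ + v₂ ∈ D ∧ v₁ 0 * v₂ 1 - v₁ 1 * v₂ 0 ≠ 0 := by
  classical
  obtain ⟨D, hD0, hDneg, hDv, hψ⟩ := exists_isLocalRealization hA hB hAB
  choose ψ hψ using hψ
  have hmem : ∀ o : PlaneObj, ∀ᶠ σ : Finset PlaneObj × ℕ in atTop, o ∈ σ.1 := fun o => by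
    filter_upwards [eventually_ge_atTop (({o}, 0) : Finset PlaneObj × ℕ)] with σ hσ
    exact hσ.1 (Finset.mem_singleton_self o)
  set U : Ultrafilter (Finset PlaneObj × ℕ) := Ultrafilter.of atTop
  have hU : (U : Filter (Finset PlaneObj × ℕ)) ≤ atTop := Ultrafilter.of_le _
  refine ⟨D, U, fun o σ => ψ σ.1 σ.2 o, ⟨fun o σ => (hψ _ _).pos o, fun σ => (hψ _ _).unit,
    fun o o' hne h => hU ?_, fun o o' hne h => hU ?_, fun v hv c => ?_, hD0, hDneg⟩, hDv⟩
  · filter_upwards [hmem o, hmem o'] with σ ho ho' using (hψ _ _).meets o ho o' ho' hne h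
  · filter_upwards [hmem o, hmem o'] with σ ho ho' using (hψ _ _).apart o ho o' ho' hne h
  · refine Tendsto.mono_left ?_ hU
    rw [tendsto_atTop]
    intro R
    obtain ⟨n, hn⟩ := exists_nat_ge R
    filter_upwards [hmem (.half v c), eventually_ge_atTop ((∅, n) : Finset PlaneObj × ℕ)]
      with σ hσ hσn
    have h1 : (n : ℝ) ≤ (σ.2 : ℝ) := by exact_mod_cast hσn.2
    exact hn.trans (h1.trans ((hψ _ _).large v hv c hσ))

theorem exists_dual_basis {v₁ v₂ : Plane} (h : v₁ 0 * v₂ 1 - v₁ 1 * v₂ 0 ≠ 0) :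
    ∃ d₁ d₂ : Plane, inner ℝ v₁ d₁ = 1 ∧ inner ℝ v₂ d₁ = 0 ∧ inner ℝ v₁ d₂ = 0 ∧
      inner ℝ v₂ d₂ = 1 ∧ ∀ x : Plane, x = (inner ℝ v₁ x : ℝ) • d₁ + (inner ℝ v₂ x : ℝ) • d₂ := by
  set δ := v₁ 0 * v₂ 1 - v₁ 1 * v₂ 0 with hδ
  refine ⟨!₂[v₂ 1 / δ, -(v₂ 0) / δ], !₂[-(v₁ 1) / δ, v₁ 0 / δ], ?_, ?_, ?_, ?_, fun x => ?_⟩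
  on_goal 5 => ext i; fin_cases i
  all_goals
    simp [PiLp.inner_apply, Fin.sum_univ_two, RCLike.inner_apply,
      Matrix.cons_val_zero, Matrix.cons_val_one]
    field_simp
    rw [hδ]
    ring

namespace IsLimitRealization

variable {A B D : Set Plane} {Ω : Type*} {U : Ultrafilter Ω} {ψ : PlaneObj → Ω → Plane × ℝ}

theorem eventuallyBounded_unit (h : IsLimitRealization A B D U ψ) :
    EventuallyBounded U (ψ (.disk 0 1)) :=
  ⟨1, Eventually.of_forall fun σ => by simp [h.unit σ]⟩

theorem meetsBall (h : IsLimitRealization A B D U ψ) (hB : IsNormalizedDisk B) {o o' : PlaneObj}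
    (hne : o ≠ o') (ho' : EventuallyBounded U (ψ o')) (hm : o.Meets A o' ∨ o'.Meets A o) :
    MeetsBall B U (ψ o) := by
  refine MeetsBall.of_meets hB (h.pos o') ho' ?_
  rcases hm with hm | hm
  · exact h.meets o o' hne hm
  · filter_upwards [h.meets o' o hne.symm hm] with σ hσ
    rwa [Set.inter_comm]

/-- A disk that is near the origin and lies between two half-planes near the origin is bounded. -/
theorem eventuallyBounded_of_between (h : IsLimitRealization A B D U ψ) (hB : IsNormalizedDisk B)
    {z : Plane} {r : NNReal} (ho : MeetsBall B U (ψ (.disk z r))) {v : Plane} (hv : v ∈ D)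
    {c₁ c₂ : ℝ} (hc : c₁ < c₂) (h₁ : MeetsBall B U (ψ (.half (-v) (-c₁))))
    (h₂ : MeetsBall B U (ψ (.half v c₂)))
    (hbt : ∀ x ∈ homothet A z r, c₁ < inner ℝ v x ∧ inner ℝ v x < c₂) :
    EventuallyBounded U (ψ (.disk z r)) := by
  refine (ho.eventuallyBounded_or hB (h.pos _)).resolve_right fun hr => ?_
  refine MeetsBall.not_three_disjoint hB ho h₁ h₂ hr (h.large _ (h.neg_mem v hv) _)
    (h.large _ hv _) (h.apart _ _ (by simp) ⟨neg_ne_zero.mpr (h.ne_zero v hv), fun x hx => ?_⟩)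
    (h.apart _ _ (by simp) ⟨h.ne_zero v hv, fun x hx => (hbt x hx).2⟩)
    (h.apart _ _ ?_ ⟨neg_ne_zero.mpr (h.ne_zero v hv), (neg_neg v).symm, by linarith⟩)
  · rw [inner_neg_left]
    exact neg_lt_neg (hbt x hx).1
  · intro he
    rw [PlaneObj.half.injEq] at he
    exact ne_neg_of_ne_zero (h.ne_zero v hv) he.1.symm

/-- The points whose images stay bounded. -/
def boundedPoints (U : Ultrafilter Ω) (ψ : PlaneObj → Ω → Plane × ℝ) : Set Plane :=
  {p | EventuallyBounded U (ψ (.disk p 0))}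

theorem mem_homothet_zero (hA : IsNormalizedDisk A) (p : Plane) :
    p ∈ homothet A p ((0 : NNReal) : ℝ) :=
  ⟨0, hA.zero_mem, by simp⟩

theorem eq_of_mem_homothet_zero {p x : Plane} (hx : x ∈ homothet A p ((0 : NNReal) : ℝ)) :
    x = p := by
  obtain ⟨a, -, rfl⟩ := hx
  simp

theorem meetsBall_half (h : IsLimitRealization A B D U ψ) (hA : IsNormalizedDisk A)
    (hB : IsNormalizedDisk B) {p : Plane} (hp : p ∈ boundedPoints U ψ) {v : Plane} (hv : v ∈ D)
    {c : ℝ} (hc : c < inner ℝ v p) : MeetsBall B U (ψ (.half v c)) :=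
  h.meetsBall hB (by simp) hp (Or.inr ⟨h.ne_zero v hv, p, mem_homothet_zero hA p, hc⟩)

theorem eventuallyBounded_of_between_points (h : IsLimitRealization A B D U ψ)
    (hA : IsNormalizedDisk A) (hB : IsNormalizedDisk B) {z : Plane} {r : NNReal}
    (ho : MeetsBall B U (ψ (.disk z r))) {v : Plane} (hv : v ∈ D) {q₁ q₂ : Plane}
    (hq₁ : q₁ ∈ boundedPoints U ψ) (hq₂ : q₂ ∈ boundedPoints U ψ) {c₁ c₂ : ℝ} (hc : c₁ < c₂)
    (h₁ : inner ℝ v q₁ < c₁) (h₂ : c₂ < inner ℝ v q₂)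
    (hbt : ∀ x ∈ homothet A z r, c₁ < inner ℝ v x ∧ inner ℝ v x < c₂) :
    EventuallyBounded U (ψ (.disk z r)) :=
  h.eventuallyBounded_of_between hB ho hv hc
    (h.meetsBall_half hA hB hq₁ (h.neg_mem v hv) (by rw [inner_neg_left]; linarith))
    (h.meetsBall_half hA hB hq₂ hv h₂) hbt

theorem homothet_mem_nhds (hA : IsNormalizedDisk A) (p : Plane) {r : ℝ} (hr : 0 < r) :
    homothet A p r ∈ 𝓝 p := by
  obtain ⟨ρ, hρ, hAρ⟩ := hA.exists_ball_subset
  refine Filter.mem_of_superset (Metric.ball_mem_nhds p (show 0 < r * ρ by positivity)) fun x hx => ?_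
  refine mem_homothet.mpr ⟨r⁻¹ • (x - p), hAρ _ ?_, ?_⟩
  · rw [norm_smul, norm_inv, Real.norm_of_nonneg hr.le, inv_mul_lt_iff₀ hr, ← dist_eq_norm]
    exact hx
  · rw [smul_inv_smul₀ hr.ne']; abel

/-- A small disk around `p` fits between the two half-planes. One bounded point in it bounds the
disk, which in turn bounds all its points. So boundedness is an open and closed condition in the
strip. -/
theorem exists_nhds_subset_boundedPoints (h : IsLimitRealization A B D U ψ)
    (hA : IsNormalizedDisk A) (hB : IsNormalizedDisk B) {v : Plane} (hv : v ∈ D) {p q₁ q₂ : Plane}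
    (hq₁ : q₁ ∈ boundedPoints U ψ) (hq₂ : q₂ ∈ boundedPoints U ψ)
    (h₁ : inner ℝ v q₁ < inner ℝ v p) (h₂ : inner ℝ v p < inner ℝ v q₂) :
    ∃ W ∈ 𝓝 p, ∀ q ∈ W, q ∈ boundedPoints U ψ → W ⊆ boundedPoints U ψ := by
  obtain ⟨M, hM, hAM⟩ := hA.exists_norm_le
  have hvn : 0 < ‖v‖ := norm_pos_iff.mpr (h.ne_zero v hv)
  obtain ⟨c₁, hc₁, hc₁'⟩ := exists_between h₁
  obtain ⟨c₂, hc₂, hc₂'⟩ := exists_between h₂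
  obtain ⟨η, hη, hηlt⟩ := exists_between
    (show 0 < min (inner ℝ v p - c₁) (c₂ - inner ℝ v p) / (‖v‖ * M) from
      div_pos (lt_min (by linarith) (by linarith)) (by positivity))
  rw [lt_div_iff₀ (by positivity)] at hηlt
  set r : NNReal := ⟨η, hη.le⟩ with hr
  have hr0 : r ≠ 0 := fun h0 => hη.ne' (congrArg NNReal.toReal h0)
  have hbt : ∀ x ∈ homothet A p r, c₁ < inner ℝ v x ∧ inner ℝ v x < c₂ := by
    rintro _ ⟨a, ha, rfl⟩
    have h3 := abs_le.mp (abs_real_inner_le_norm v a)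
    have h4 : ‖v‖ * ‖a‖ ≤ ‖v‖ * M := mul_le_mul_of_nonneg_left (hAM a ha) hvn.le
    have h5 : |η * inner ℝ v a| < min (inner ℝ v p - c₁) (c₂ - inner ℝ v p) := by
      refine lt_of_le_of_lt ?_ hηlt
      rw [abs_mul, abs_of_pos hη]
      exact mul_le_mul_of_nonneg_left ((abs_real_inner_le_norm v a).trans h4) hη.le
    rw [lt_min_iff, abs_lt, abs_lt] at h5
    have h6 : inner ℝ v (p + (r : ℝ) • a) = inner ℝ v p + η * inner ℝ v a := by
      rw [inner_add_right, real_inner_smul_right]; rfl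
    show c₁ < inner ℝ v (p + (r : ℝ) • a) ∧ inner ℝ v (p + (r : ℝ) • a) < c₂
    rw [h6]
    constructor <;> linarith [h5.1.1, h5.2.2]
  have hc : c₁ < c₂ := by linarith
  refine ⟨homothet A p r, homothet_mem_nhds hA p hη, fun q hq hqE => ?_⟩
  have hX : EventuallyBounded U (ψ (.disk p r)) := by
    refine h.eventuallyBounded_of_between_points hA hB ?_ hv hq₁ hq₂ hc hc₁ hc₂' hbt
    exact h.meetsBall hB (by simp [hr0]) hqE (Or.inl ⟨q, hq, mem_homothet_zero hA q⟩)
  intro x hx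
  refine h.eventuallyBounded_of_between_points hA hB ?_ hv hq₁ hq₂ hc hc₁ hc₂' ?_
  · exact h.meetsBall hB (by simp [hr0.symm]) hX (Or.inl ⟨x, mem_homothet_zero hA x, hx⟩)
  · intro y hy
    rw [eq_of_mem_homothet_zero hy]
    exact hbt x hx

theorem strip_subset_boundedPoints (h : IsLimitRealization A B D U ψ) (hA : IsNormalizedDisk A)
    (hB : IsNormalizedDisk B) {v : Plane} (hv : v ∈ D) {q q₁ q₂ : Plane}
    (hq : q ∈ boundedPoints U ψ) (hq₁ : q₁ ∈ boundedPoints U ψ) (hq₂ : q₂ ∈ boundedPoints U ψ)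
    (h₁ : inner ℝ v q₁ < inner ℝ v q) (h₂ : inner ℝ v q < inner ℝ v q₂) :
    {p | inner ℝ v p ∈ Set.Ioo (inner ℝ v q₁ : ℝ) (inner ℝ v q₂)} ⊆ boundedPoints U ψ := by
  have hconv : Convex ℝ {p : Plane | inner ℝ v p ∈ Set.Ioo (inner ℝ v q₁ : ℝ) (inner ℝ v q₂)} :=
    (convex_Ioo (inner ℝ v q₁ : ℝ) (inner ℝ v q₂)).is_linear_preimage
      ⟨fun x y => inner_add_right v x y, fun c x => real_inner_smul_right v x c⟩
  refine (hconv.isPreconnected.subset_of_closure_inter_subset isOpen_interior ⟨q, ⟨h₁, h₂⟩, ?_⟩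
    ?_).trans interior_subset
  · obtain ⟨W, hW, hWE⟩ := h.exists_nhds_subset_boundedPoints hA hB hv hq₁ hq₂ h₁ h₂
    exact mem_interior_iff_mem_nhds.mpr
      (Filter.mem_of_superset hW (hWE q (mem_of_mem_nhds hW) hq))
  · rintro p ⟨hp, hpS⟩
    obtain ⟨W, hW, hWE⟩ := h.exists_nhds_subset_boundedPoints hA hB hv hq₁ hq₂ hpS.1 hpS.2
    obtain ⟨x, hxW, hx⟩ := mem_closure_iff_nhds.mp hp W hW
    exact mem_interior_iff_mem_nhds.mpr (Filter.mem_of_superset hW (hWE x hxW (interior_subset hx)))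

/-- The image of the unit disk is fixed, so half-planes cutting into `A` stay near the origin. They
bound the points of a short segment along `v`, and the strip spanned by the segment follows. -/
theorem exists_slab_subset_boundedPoints (h : IsLimitRealization A B D U ψ)
    (hA : IsNormalizedDisk A) (hB : IsNormalizedDisk B) {v : Plane} (hv : v ∈ D) :
    0 ∈ boundedPoints U ψ ∧ ∃ κ : ℝ, 0 < κ ∧ {p | |inner ℝ v p| < κ} ⊆ boundedPoints U ψ := by
  obtain ⟨ρ, hρ, hAρ⟩ := hA.exists_ball_subset
  have hvn : 0 < ‖v‖ := norm_pos_iff.mpr (h.ne_zero v hv)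
  -- `A` contains the ball of radius `ρ`: the point at distance `3ρ/4` lies strictly beyond the
  -- level `ρ‖v‖/2`, and points within `ρ/4` lie strictly before it.
  have hnear : ∀ w ∈ D, ‖w‖ = ‖v‖ → MeetsBall B U (ψ (.half w (ρ * ‖v‖ / 2))) := by
    intro w hw hwv
    refine h.meetsBall hB (by simp) h.eventuallyBounded_unit (Or.inr ⟨h.ne_zero w hw,
      (3 / 4 * ρ / ‖v‖) • w, ⟨(3 / 4 * ρ / ‖v‖) • w, hAρ _ ?_, by simp⟩, ?_⟩)
    · rw [norm_smul, hwv, Real.norm_of_nonneg (by positivity), div_mul_cancel₀ _ hvn.ne']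
      linarith
    · rw [real_inner_smul_right, real_inner_self_eq_norm_sq, hwv]
      have : 3 / 4 * ρ / ‖v‖ * ‖v‖ ^ 2 = 3 / 4 * (ρ * ‖v‖) := by field_simp
      rw [this]
      have : 0 < ρ * ‖v‖ := by positivity
      linarith
  have hpt : ∀ τ : ℝ, |τ| ≤ ρ / (4 * ‖v‖) → τ • v ∈ boundedPoints U ψ := by
    intro τ hτ
    rw [le_div_iff₀ (by positivity)] at hτ
    have hvv : inner ℝ v (τ • v) = τ * ‖v‖ * ‖v‖ := by
      rw [real_inner_smul_right, real_inner_self_eq_norm_sq]; ring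
    have hA' : τ • v ∈ A := hAρ _ (by rw [norm_smul, Real.norm_eq_abs]; linarith)
    refine h.eventuallyBounded_of_between hB ?_ hv (c₁ := -(ρ * ‖v‖ / 2)) (c₂ := ρ * ‖v‖ / 2)
      ?_ ?_ (hnear v hv rfl) ?_
    · exact h.meetsBall hB (by simp) h.eventuallyBounded_unit
        (Or.inl ⟨_, mem_homothet_zero hA _, τ • v, hA', by simp⟩)
    · have : 0 < ρ * ‖v‖ := by positivity
      linarith
    · rw [neg_neg]
      exact hnear (-v) (h.neg_mem v hv) (norm_neg v)
    · intro x hx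
      rw [eq_of_mem_homothet_zero hx, hvv]
      have h1 : |τ * ‖v‖| < ρ / 2 := by rw [abs_mul, abs_norm]; linarith
      rw [abs_lt] at h1
      constructor <;> nlinarith [h1.1, h1.2]
  have h0 : 0 ∈ boundedPoints U ψ := by
    have := hpt 0 (by rw [abs_zero]; positivity)
    rwa [zero_smul] at this
  refine ⟨h0, ρ / (4 * ‖v‖) * ‖v‖ ^ 2, by positivity, fun p hp => ?_⟩
  have hτ : 0 < ρ / (4 * ‖v‖) := by positivity
  refine h.strip_subset_boundedPoints hA hB hv h0 (hpt (-(ρ / (4 * ‖v‖))) ?_)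
    (hpt (ρ / (4 * ‖v‖)) ?_) ?_ ?_ ?_
  · rw [abs_neg, abs_of_pos hτ]
  · rw [abs_of_pos hτ]
  · rw [real_inner_smul_right, inner_zero_right, real_inner_self_eq_norm_sq]
    have : 0 < ρ / (4 * ‖v‖) * ‖v‖ ^ 2 := by positivity
    linarith
  · rw [real_inner_smul_right, inner_zero_right, real_inner_self_eq_norm_sq]
    positivity
  · have hp' := abs_lt.mp (show |inner ℝ v p| < _ from hp)
    show inner ℝ v p ∈ Set.Ioo _ _
    rw [real_inner_smul_right, real_inner_smul_right, real_inner_self_eq_norm_sq]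
    exact ⟨by linarith [hp'.1], hp'.2⟩

/-- The slab for `v₁` contains the line spanned by `d₂`, on which `v₂` is unbounded both ways, so
strips for `v₂` between its points exhaust the plane. -/
theorem mem_boundedPoints (h : IsLimitRealization A B D U ψ) (hA : IsNormalizedDisk A)
    (hB : IsNormalizedDisk B) {v₁ v₂ : Plane} (hv₁ : v₁ ∈ D) (hv₂ : v₂ ∈ D)
    (hdet : v₁ 0 * v₂ 1 - v₁ 1 * v₂ 0 ≠ 0) (p : Plane) : p ∈ boundedPoints U ψ := by
  obtain ⟨d₁, d₂, -, -, h12, h22, -⟩ := exists_dual_basis hdet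
  obtain ⟨h0, κ, hκ, hslab⟩ := h.exists_slab_subset_boundedPoints hA hB hv₁
  have hmem : ∀ s : ℝ, s • d₂ ∈ boundedPoints U ψ := fun s => hslab (by
    show |inner ℝ v₁ (s • d₂)| < κ
    rw [real_inner_smul_right, h12, mul_zero, abs_zero]
    exact hκ)
  have hin : ∀ s : ℝ, inner ℝ v₂ (s • d₂) = s := fun s => by
    rw [real_inner_smul_right, h22, mul_one]
  have hpos : 0 < |inner ℝ v₂ p| + 1 := by positivity
  refine h.strip_subset_boundedPoints hA hB hv₂ h0 (hmem (-(|inner ℝ v₂ p| + 1)))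
    (hmem (|inner ℝ v₂ p| + 1)) ?_ ?_ ?_
  · rw [hin, inner_zero_right]; linarith
  · rw [hin, inner_zero_right]; linarith
  · show inner ℝ v₂ p ∈ Set.Ioo _ _
    rw [hin, hin]
    exact ⟨by linarith [neg_abs_le (inner ℝ v₂ p)], by linarith [le_abs_self (inner ℝ v₂ p)]⟩

end IsLimitRealization

/-! ### Limits of half-planes, disks and points -/

theorem EventuallyBounded.exists_tendsto {Ω : Type*} {U : Ultrafilter Ω} {X : Ω → Plane × ℝ}
    (hpos : ∀ σ, 0 < (X σ).2) (hX : EventuallyBounded U X) : ∃ x, Tendsto X U (𝓝 x) := by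
  obtain ⟨R, hR⟩ := hX
  refine Ultrafilter.exists_tendsto_of_norm_le (R := R) ?_
  filter_upwards [hR] with σ hσ
  rw [Prod.norm_def, Real.norm_of_nonneg (hpos σ).le]
  exact max_le hσ.1 hσ.2

namespace IsLimitRealization

variable {A B D : Set Plane} {Ω : Type*} {U : Ultrafilter Ω} {ψ : PlaneObj → Ω → Plane × ℝ}

theorem meetsBall_half_of_forall (h : IsLimitRealization A B D U ψ) (hA : IsNormalizedDisk A)
    (hB : IsNormalizedDisk B) (hE : ∀ p, p ∈ boundedPoints U ψ) {v : Plane} (hv : v ∈ D) (c : ℝ) :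
    MeetsBall B U (ψ (.half v c)) := by
  have hvn : 0 < ‖v‖ := norm_pos_iff.mpr (h.ne_zero v hv)
  refine h.meetsBall_half hA hB (hE (((c + 1) / ‖v‖ ^ 2) • v)) hv ?_
  rw [inner_smul_div_norm_sq (h.ne_zero v hv)]
  linarith

theorem eventuallyBounded_disk (h : IsLimitRealization A B D U ψ) (hA : IsNormalizedDisk A)
    (hB : IsNormalizedDisk B) (hE : ∀ p, p ∈ boundedPoints U ψ) {v : Plane} (hv : v ∈ D)
    (z : Plane) (r : NNReal) : EventuallyBounded U (ψ (.disk z r)) := by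
  by_cases hr : r = 0
  · rw [hr]; exact hE z
  obtain ⟨C, hC⟩ := (hA.isCompact_homothet z r).exists_bound_of_continuousOn
    (f := fun x => inner ℝ v x) (by fun_prop)
  have hC0 : 0 ≤ C := (norm_nonneg _).trans (hC z ⟨0, hA.zero_mem, by simp⟩)
  refine h.eventuallyBounded_of_between hB ?_ hv (c₁ := -(C + 1)) (c₂ := C + 1) (by linarith)
    (h.meetsBall_half_of_forall hA hB hE (h.neg_mem v hv) _)
    (h.meetsBall_half_of_forall hA hB hE hv _) ?_
  · exact h.meetsBall hB (by simp [hr]) (hE z)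
      (Or.inl ⟨z, ⟨0, hA.zero_mem, by simp⟩, mem_homothet_zero hA z⟩)
  · intro x hx
    have := abs_le.mp (hC x hx)
    constructor <;> linarith [this.1, this.2]

/-- All half-planes with inner normal `v` have the same limit normal `u`. -/
theorem exists_limit_normal (h : IsLimitRealization A B D U ψ) (hA : IsNormalizedDisk A)
    (hB : IsNormalizedDisk B) (hE : ∀ p, p ∈ boundedPoints U ψ) {v : Plane} (hv : v ∈ D) :
    ∃ u : Plane, ‖u‖ = 1 ∧ ∀ c,
      (∀ b ∈ B, Contact B U (ψ (.half v c)) b → IsInnerNormal B b u) ∧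
      (∀ b ∈ B, Contact B U (ψ (.half (-v) c)) b → IsInnerNormal B b (-u)) := by
  have hv' := h.neg_mem v hv
  have hcon : ∀ w ∈ D, ∀ c, ∃ b ∈ B, Contact B U (ψ (.half w c)) b := fun w hw c =>
    (h.meetsBall_half_of_forall hA hB hE hw c).exists_contact hB (h.large w hw c)
  have hopp : ∀ c c' b b', 0 < c + c' → Contact B U (ψ (.half v c)) b →
      Contact B U (ψ (.half (-v) c')) b' → ∃ u, IsInnerNormal B b u ∧ IsInnerNormal B b' (-u) := by
    intro c c' b b' hc hb hb'
    refine hb.exists_isInnerNormal_neg hB hb' (h.apart _ _ ?_ ⟨h.ne_zero v hv, rfl, hc⟩)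
    intro he
    rw [PlaneObj.half.injEq] at he
    exact ne_neg_of_ne_zero (h.ne_zero v hv) he.1
  obtain ⟨b₀, hb₀, hc₀⟩ := hcon v hv 0
  obtain ⟨b₁, hb₁, hc₁⟩ := hcon (-v) hv' 1
  obtain ⟨u, hu, -⟩ := hopp 0 1 b₀ b₁ (by norm_num) hc₀ hc₁
  have hfst : ∀ c, ∀ b ∈ B, Contact B U (ψ (.half v c)) b → IsInnerNormal B b u := by
    intro c b hb hcb
    -- The opposite half-plane at level `|c| + 1` is apart from those at levels `c` and `0`, and so
    -- ties their normals together.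
    obtain ⟨b', hb', hcb'⟩ := hcon (-v) hv' (|c| + 1)
    obtain ⟨w, hw, hw'⟩ := hopp c (|c| + 1) b b' (by linarith [neg_abs_le c]) hcb hcb'
    obtain ⟨w₀, hw₀, hw₀'⟩ := hopp 0 (|c| + 1) b₀ b' (by positivity) hc₀ hcb'
    obtain rfl := hu.unique hB hb₀ hw₀
    rwa [neg_injective (hw₀'.unique hB hb' hw')]
  refine ⟨u, hu.1, fun c => ⟨hfst c, fun b hb hcb => ?_⟩⟩
  obtain ⟨b', hb', hcb'⟩ := hcon v hv (|c| + 1)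
  obtain ⟨w, hw, hw'⟩ := hopp (|c| + 1) c b' b (by linarith [neg_abs_le c]) hcb' hcb
  rwa [(hfst _ b' hb' hcb').unique hB hb' hw]

/-- In the limit, a disk and a point on different sides of a line are on different sides of a line
with the corresponding normal, up to the size of the image of the point. -/
theorem inner_limit_le (h : IsLimitRealization A B D U ψ) (hA : IsNormalizedDisk A)
    (hB : IsNormalizedDisk B) (hE : ∀ p, p ∈ boundedPoints U ψ) {M : ℝ} (hM : ∀ b ∈ B, ‖b‖ ≤ M)
    {v : Plane} (hv : v ∈ D) {u : Plane} {c : ℝ}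
    (hu : ∀ b ∈ B, Contact B U (ψ (.half v c)) b → IsInnerNormal B b u) {z q : Plane} {r : NNReal}
    {x y : Plane × ℝ} (hx : Tendsto (ψ (.disk z r)) U (𝓝 x))
    (hy : Tendsto (ψ (.disk q 0)) U (𝓝 y)) (hz : ∀ a ∈ homothet A z r, inner ℝ v a < c)
    (hq : c < inner ℝ v q) {b : Plane} (hb : b ∈ B) :
    inner ℝ u (x.1 + x.2 • b) ≤ inner ℝ u y.1 + y.2 * M := by
  have hH := h.meetsBall_half_of_forall hA hB hE hv c
  obtain ⟨b₀, hb₀, hc₀⟩ := hH.exists_contact hB (h.large v hv c)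
  have hd := h.apart (.disk z r) (.half v c) (by simp) ⟨h.ne_zero v hv, hz⟩
  obtain ⟨ν, g, u', γ, hu', hν, hg, h1, h2⟩ := exists_tendsto_separation hB hH
    ((h.eventuallyBounded_disk hA hB hE hv z r).meetsBall hB)
    (by filter_upwards [hd] with σ hσ using hσ.symm)
  obtain rfl := (hu b₀ hb₀ hc₀).unique hB hb₀ (hc₀.isInnerNormal hu' hν hg h1)
  have hxγ : inner ℝ u (x.1 + x.2 • b) ≤ γ := by
    refine le_of_tendsto_of_tendsto (hν.inner (hx.fst_nhds.add (hx.snd_nhds.smul_const b))) hg ?_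
    filter_upwards [h2] with σ hσ using hσ b hb
  refine hxγ.trans ?_
  -- The point's image meets that of the half-plane, so it reaches beyond the separating line; its
  -- centre does so up to its size.
  have hlim : Tendsto (fun σ => inner ℝ (ν σ) (ψ (.disk q 0) σ).1 +
      ‖ν σ‖ * ((ψ (.disk q 0) σ).2 * M)) U (𝓝 (inner ℝ u y.1 + ‖u‖ * (y.2 * M))) :=
    (hν.inner hy.fst_nhds).add (hν.norm.mul (hy.snd_nhds.mul_const M))
  rw [hu', one_mul] at hlim
  refine le_of_tendsto_of_tendsto hg hlim ?_
  filter_upwards [h1, h.meets (.disk q 0) (.half v c) (by simp)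
    ⟨h.ne_zero v hv, q, mem_homothet_zero hA q, hq⟩] with σ hσ ⟨w, ⟨b₁, hb₁, hw₁⟩, ⟨b₂, hb₂, hw₂⟩⟩
  have h3 := hσ b₂ hb₂
  rw [show (ψ (.half v c) σ).1 + (ψ (.half v c) σ).2 • b₂ =
    (ψ (.disk q 0) σ).1 + (ψ (.disk q 0) σ).2 • b₁ from hw₂.trans hw₁.symm, inner_add_right,
    real_inner_smul_right] at h3
  refine h3.trans (add_le_add_right ?_ _)
  have hp := h.pos (.disk q 0) σ
  have h4 : inner ℝ (ν σ) b₁ ≤ ‖ν σ‖ * M :=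
    (real_inner_le_norm _ _).trans (mul_le_mul_of_nonneg_left (hM b₁ hb₁) (norm_nonneg _))
  calc _ ≤ (ψ (.disk q 0) σ).2 * (‖ν σ‖ * M) := mul_le_mul_of_nonneg_left h4 hp.le
    _ = _ := by ring

/-- Near every point there are points whose images are small in the limit. -/
theorem exists_small_limit (h : IsLimitRealization A B D U ψ) (hA : IsNormalizedDisk A)
    (hB : IsNormalizedDisk B) {M : ℝ} (hM : ∀ b ∈ B, ‖b‖ ≤ M) {L : Plane → Plane × ℝ}
    (hL : ∀ p, Tendsto (ψ (.disk p 0)) U (𝓝 (L p))) {p : Plane}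
    (hX : EventuallyBounded U (ψ (.disk p 1))) :
    ∃ R : ℝ, ∀ δ : ℝ, 0 < δ → ∃ q, ‖q - p‖ < δ ∧ ‖(L q).1‖ ≤ R + M * δ ∧ (L q).2 ≤ δ := by
  obtain ⟨ρ, hρ, hAρ⟩ := hA.exists_ball_subset
  obtain ⟨R₀, hR₀⟩ := hX
  have hM0 : 0 ≤ M := (norm_nonneg _).trans (hM 0 hB.zero_mem)
  have hR₀pos : 0 < R₀ := by
    obtain ⟨σ, hσ⟩ := hR₀.exists
    exact (h.pos _ σ).trans_le hσ.2
  refine ⟨R₀ + R₀ * M, fun δ hδ => ?_⟩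
  -- If all `N` points `q i` in the disk around `p` had images larger than `δ`, these disjoint sets
  -- meeting the disk's image, of ratio at most `R₀`, would violate the packing bound.
  obtain ⟨N, hN⟩ := hB.exists_lt_of_pairwise_disjoint (ε := δ / R₀) (by positivity)
  set e : Plane := EuclideanSpace.single 0 1 with he
  have hen : ‖e‖ = 1 := by simp [he]
  set τ : ℝ := min δ ρ / (N + 1) with hτ
  have hmin : 0 < min δ ρ := lt_min hδ hρ
  have hτ0 : 0 < τ := by positivity
  set q : Fin N → Plane := fun i => p + (τ * i) • e with hq
  have hqn : ∀ i, ‖q i - p‖ < min δ ρ := fun i => by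
    simp only [hq, add_sub_cancel_left]
    rw [norm_smul, hen, mul_one, Real.norm_of_nonneg (by positivity), hτ, div_mul_eq_mul_div,
      div_lt_iff₀ (by positivity)]
    have : (i : ℝ) < N + 1 := by
      have := i.2
      have : ((i : ℕ) : ℝ) < N := by exact_mod_cast this
      linarith
    exact mul_lt_mul_of_pos_left this hmin
  have hqinj : ∀ i j, i ≠ j → q i ≠ q j := by
    intro i j hij heq
    have h1 : (τ * i) • e = (τ * j) • e := add_left_cancel heq
    have he0 : e ≠ 0 := by rw [← norm_ne_zero_iff, hen]; exact one_ne_zero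
    have h2 := mul_left_cancel₀ hτ0.ne' (smul_left_injective ℝ he0 h1)
    exact hij (Fin.ext (by exact_mod_cast h2))
  have hqX : ∀ i, PlaneObj.Meets A (.disk (q i) 0) (.disk p 1) := fun i =>
    ⟨q i, mem_homothet_zero hA _, q i - p, hAρ _ ((hqn i).trans_le (min_le_right _ _)), by simp⟩
  have hmeet := fun i => h.meets _ _ (by simp) (hqX i)
  have hex : ∃ i, (L (q i)).2 ≤ δ := by
    by_contra! hcon
    have hlarge : ∀ᶠ σ in (U : Filter Ω), ∀ i, δ < (ψ (.disk (q i) 0) σ).2 :=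
      eventually_all.mpr fun i => (hL (q i)).snd_nhds.eventually (lt_mem_nhds (hcon i))
    have hdisj : ∀ᶠ σ in (U : Filter Ω), ∀ i j, i ≠ j →
        Disjoint (homothet B (ψ (.disk (q i) 0) σ).1 (ψ (.disk (q i) 0) σ).2)
          (homothet B (ψ (.disk (q j) 0) σ).1 (ψ (.disk (q j) 0) σ).2) := by
      refine eventually_all.mpr fun i => eventually_all.mpr fun j =>
        eventually_imp_distrib_left.mpr fun hij => h.apart _ _ (by simpa using hqinj i j hij) ?_
      show Disjoint (homothet A (q i) _) (homothet A (q j) _)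
      rw [Set.disjoint_left]
      intro x hx hx'
      exact hqinj i j hij ((eq_of_mem_homothet_zero hx).symm.trans (eq_of_mem_homothet_zero hx'))
    obtain ⟨σ, h1, h2, h3, h4⟩ :=
      (hlarge.and (hdisj.and ((eventually_all.mpr hmeet).and hR₀))).exists
    obtain ⟨i, hi⟩ := hN _ _ _ _ (h.pos (.disk p 1) σ) (fun i => h.pos (.disk (q i) 0) σ) h2 h3
    have h5 : δ / R₀ * (ψ (.disk p 1) σ).2 ≤ δ / R₀ * R₀ :=
      mul_le_mul_of_nonneg_left h4.2 (by positivity)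
    rw [div_mul_cancel₀ _ hR₀pos.ne'] at h5
    linarith [h1 i]
  obtain ⟨i, hi⟩ := hex
  refine ⟨q i, (hqn i).trans_le (min_le_left _ _), ?_, hi⟩
  have hle : ‖(L (q i)).1‖ ≤ R₀ + R₀ * M + (L (q i)).2 * M := by
    refine le_of_tendsto_of_tendsto (hL (q i)).fst_nhds.norm
      (((hL (q i)).snd_nhds.mul_const M).const_add (R₀ + R₀ * M)) ?_
    filter_upwards [hmeet i, hR₀] with σ ⟨x, ⟨b, hb, hbx⟩, ⟨c, hc, hcx⟩⟩ hσ
    have hz : (ψ (.disk (q i) 0) σ).1 = (ψ (.disk p 1) σ).1 + (ψ (.disk p 1) σ).2 • c -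
        (ψ (.disk (q i) 0) σ).2 • b := by
      rw [show (ψ (.disk p 1) σ).1 + (ψ (.disk p 1) σ).2 • c =
        (ψ (.disk (q i) 0) σ).1 + (ψ (.disk (q i) 0) σ).2 • b from hcx.trans hbx.symm]
      abel
    rw [hz]
    refine (norm_sub_le _ _).trans (add_le_add ((norm_add_le _ _).trans (add_le_add hσ.1 ?_)) ?_)
    · rw [norm_smul, Real.norm_of_nonneg (h.pos _ σ).le]
      exact mul_le_mul hσ.2 (hM c hc) (norm_nonneg _) hR₀pos.le
    · rw [norm_smul, Real.norm_of_nonneg (h.pos _ σ).le]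
      exact mul_le_mul_of_nonneg_left (hM b hb) (h.pos _ σ).le
  have : (L (q i)).2 * M ≤ δ * M := mul_le_mul_of_nonneg_right hi hM0
  linarith

end IsLimitRealization

/-! ### The limit map -/

/-- A map of the plane that maps points of `A` to `B` and other points outside the interior of `B`,
and that preserves the order of points in the directions of `D`. -/
structure IsLimitMap (A B D : Set Plane) (φ : Plane → Plane) : Prop where
  exists_normal : ∀ v ∈ D, ∃ u : Plane, ‖u‖ = 1 ∧
    (∀ p p', inner ℝ v p < inner ℝ v p' → (inner ℝ u (φ p) : ℝ) ≤ inner ℝ u (φ p')) ∧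
    ∃ c : ℝ, (∀ p, c < inner ℝ v p → ∀ b ∈ B, (inner ℝ u b : ℝ) ≤ inner ℝ u (φ p)) ∧
      ∀ p, inner ℝ v p < -c → ∀ b ∈ B, (inner ℝ u (φ p) : ℝ) ≤ inner ℝ u b
  mem : ∀ p ∈ interior A, φ p ∈ B
  notMem : ∀ p, p ∉ A → φ p ∉ interior B

/-- The limit image of a point may have positive size, so `φ p` is a limit of centres of images of
points `q k` tending to `p` whose sizes vanish. The size errors in the estimates then disappear. -/
theorem IsLimitRealization.exists_isLimitMap {A B D : Set Plane} {Ω : Type*} {U : Ultrafilter Ω}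
    {ψ : PlaneObj → Ω → Plane × ℝ} (h : IsLimitRealization A B D U ψ) (hA : IsNormalizedDisk A)
    (hB : IsNormalizedDisk B) {v₁ v₂ : Plane} (hv₁ : v₁ ∈ D) (hv₂ : v₂ ∈ D)
    (hdet : v₁ 0 * v₂ 1 - v₁ 1 * v₂ 0 ≠ 0) : ∃ φ, IsLimitMap A B D φ := by
  have hE : ∀ p, p ∈ boundedPoints U ψ := h.mem_boundedPoints hA hB hv₁ hv₂ hdet
  obtain ⟨M, hM0, hM⟩ := hB.exists_norm_le
  have hlim : ∀ p, ∃ x, Tendsto (ψ (.disk p 0)) U (𝓝 x) := fun p =>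
    (hE p).exists_tendsto (h.pos _)
  choose L hL using hlim
  have hL0 : ∀ p, 0 ≤ (L p).2 := fun p =>
    ge_of_tendsto (hL p).snd_nhds (Eventually.of_forall fun σ => (h.pos _ σ).le)
  have hseq : ∀ p, ∃ (x : Plane) (q : ℕ → Plane), Tendsto q (hyperfilter ℕ) (𝓝 p) ∧
      Tendsto (fun k => (L (q k)).1) (hyperfilter ℕ) (𝓝 x) ∧
      Tendsto (fun k => (L (q k)).2) (hyperfilter ℕ) (𝓝 0) := by
    intro p
    obtain ⟨R, hR⟩ := h.exists_small_limit hA hB hM hL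
      (h.eventuallyBounded_disk hA hB hE hv₁ p 1)
    choose q hq1 hq2 hq3 using fun k : ℕ => hR (1 / ((k : ℝ) + 1)) (by positivity)
    have hle : (hyperfilter ℕ : Filter ℕ) ≤ atTop := Nat.hyperfilter_le_atTop
    have h0 : Tendsto (fun k : ℕ => 1 / ((k : ℝ) + 1)) (hyperfilter ℕ) (𝓝 0) :=
      tendsto_one_div_add_atTop_nhds_zero_nat.mono_left hle
    obtain ⟨x, hx⟩ := Ultrafilter.exists_tendsto_of_norm_le (U := hyperfilter ℕ)
      (f := fun k => (L (q k)).1) (R := R + M) (Eventually.of_forall fun k => by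
        refine (hq2 k).trans (add_le_add_right (mul_le_of_le_one_right hM0.le ?_) _)
        rw [div_le_one (by positivity)]
        have : (0 : ℝ) ≤ k := k.cast_nonneg
        linarith)
    refine ⟨x, q, ?_, hx, ?_⟩
    · rw [tendsto_iff_norm_sub_tendsto_zero]
      exact squeeze_zero (fun k => norm_nonneg _) (fun k => (hq1 k).le) h0
    · exact squeeze_zero (fun k => hL0 _) hq3 h0
  choose φ q hq hφ hr using hseq
  refine ⟨φ, fun v hv => ?_, fun p hp => ?_, fun p hp => ?_⟩
  · obtain ⟨u, hu, hcon⟩ := h.exists_limit_normal hA hB hE hv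
    obtain ⟨C, hC⟩ := hA.isCompact.exists_bound_of_continuousOn
      (f := fun x => inner ℝ v x) (by fun_prop)
    have hZ : Tendsto (ψ (.disk 0 1)) U (𝓝 (0, 1)) := by
      rw [funext h.unit]; exact tendsto_const_nhds
    have hZA : ∀ a ∈ homothet A 0 ((1 : NNReal) : ℝ), a ∈ A := by
      rintro _ ⟨a, ha, rfl⟩
      simpa using ha
    have hlimu : ∀ (w : Plane) (p : Plane), Tendsto (fun k => inner ℝ w (L (q p k)).1 +
        (L (q p k)).2 * M) (hyperfilter ℕ) (𝓝 (inner ℝ w (φ p))) := fun w p => by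
      have := (tendsto_const_nhds (x := w)).inner (hφ p) |>.add ((hr p).mul_const M)
      simpa using this
    have hcont : ∀ (w : Plane) (p : Plane), Tendsto (fun k => inner ℝ w (q p k)) (hyperfilter ℕ)
        (𝓝 (inner ℝ w p : ℝ)) := fun w p => tendsto_const_nhds.inner (hq p)
    refine ⟨u, hu, fun p p' hpp' => ?_, C + 1, fun p hp b hb => ?_, fun p hp b hb => ?_⟩
    · obtain ⟨c, hc, hc'⟩ := exists_between hpp'
      refine le_of_tendsto_of_tendsto (tendsto_const_nhds.inner (hφ p)) (hlimu u p') ?_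
      filter_upwards [(hcont v p).eventually (gt_mem_nhds hc),
        (hcont v p').eventually (lt_mem_nhds hc')] with k hk hk'
      have := h.inner_limit_le hA hB hE hM hv (hcon c).1 (hL (q p k)) (hL (q p' k))
        (fun a ha => by rw [eq_of_mem_homothet_zero ha]; exact hk) hk' hB.zero_mem
      simpa using this
    · refine ge_of_tendsto (hlimu u p) ?_
      filter_upwards [(hcont v p).eventually (lt_mem_nhds hp)] with k hk
      have := h.inner_limit_le hA hB hE hM hv (hcon (C + 1)).1 hZ (hL (q p k))
        (fun a ha => by linarith [(abs_le.mp (hC a (hZA a ha))).2]) hk hb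
      simpa using this
    · have hlim' := hlimu (-u) p
      rw [← neg_le_neg_iff, ← inner_neg_left, ← inner_neg_left]
      refine ge_of_tendsto hlim' ?_
      filter_upwards [(hcont v p).eventually (gt_mem_nhds hp)] with k hk
      have := h.inner_limit_le hA hB hE hM (h.neg_mem v hv) (hcon (C + 1)).2 hZ (hL (q p k))
        (fun a ha => by
          rw [inner_neg_left]; linarith [(abs_le.mp (hC a (hZA a ha))).1])
        (by rw [inner_neg_left]; linarith) hb
      simpa using this
  · have hinf : ∀ x ∈ A, Metric.infDist (L x).1 B ≤ (L x).2 * M := by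
      intro x hx
      refine le_of_tendsto_of_tendsto
        (((Metric.continuous_infDist_pt B).tendsto _).comp (hL x).fst_nhds)
        ((hL x).snd_nhds.mul_const M) ?_
      filter_upwards [h.meets (.disk x 0) (.disk 0 1) (by simp)
        ⟨x, mem_homothet_zero hA x, x, hx, by simp⟩] with σ ⟨y, ⟨b, hb, hby⟩, ⟨c, hc, hcy⟩⟩
      rw [h.unit σ] at hcy
      simp only [one_smul, zero_add] at hcy
      subst hcy
      refine (Metric.infDist_le_dist_of_mem hc).trans ?_
      rw [dist_eq_norm, ← hby, sub_add_cancel_left, norm_neg, norm_smul,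
        Real.norm_of_nonneg (h.pos _ σ).le]
      exact mul_le_mul_of_nonneg_left (hM b hb) (h.pos _ σ).le
    rw [hB.isCompact.isClosed.mem_iff_infDist_zero ⟨0, hB.zero_mem⟩]
    refine le_antisymm ?_ Metric.infDist_nonneg
    have h0 : Tendsto (fun k => (L (q p k)).2 * M) (hyperfilter ℕ) (𝓝 0) := by
      simpa using (hr p).mul_const M
    refine le_of_tendsto_of_tendsto
      (((Metric.continuous_infDist_pt B).tendsto _).comp (hφ p)) h0 ?_
    filter_upwards [(hq p).eventually (mem_interior_iff_mem_nhds.mp hp)] with k hk using hinf _ hk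
  · have hout : ∀ x, x ∉ A → (L x).1 ∉ interior B := by
      intro x hx hxB
      have hap := h.apart (.disk x 0) (.disk 0 1) (by simp) (by
        show Disjoint (homothet A x _) (homothet A 0 _)
        rw [Set.disjoint_left]
        rintro y hy ⟨a, ha, hay⟩
        rw [eq_of_mem_homothet_zero hy] at hay
        simp only [NNReal.coe_one, one_smul, zero_add] at hay
        exact hx (hay ▸ ha))
      obtain ⟨σ, h1, h2⟩ :=
        (hap.and ((hL x).fst_nhds.eventually (isOpen_interior.mem_nhds hxB))).exists
      have h3 : (ψ (.disk x 0) σ).1 ∈ interior B := h2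
      rw [h.unit σ] at h1
      have hin : (ψ (.disk x 0) σ).1 ∈
          homothet B (ψ (.disk x 0) σ).1 (ψ (.disk x 0) σ).2 := ⟨0, hB.zero_mem, by simp⟩
      exact Set.disjoint_left.mp h1 hin ⟨_, interior_subset h3, by simp⟩
    intro hpB
    obtain ⟨k, h1, h2⟩ := (((hq p).eventually (hA.isCompact.isClosed.isOpen_compl.mem_nhds hp)).and
      ((hφ p).eventually (isOpen_interior.mem_nhds hpB))).exists
    exact hout _ h1 h2

/-! ### Monotonicity in three directions forces an affine map -/

/-- A function of points that is monotone in the coordinate `⟪v, ·⟫` is, up to values at jumps, a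
monotone function of this coordinate. -/
theorem exists_monotone_of_inner_lt {v d : Plane} (hvd : inner ℝ v d = 1) {F : Plane → ℝ}
    (hF : ∀ p p', inner ℝ v p < inner ℝ v p' → F p ≤ F p') :
    ∃ g : ℝ → ℝ, Monotone g ∧ (∀ q x, x < inner ℝ v q → g x ≤ F q) ∧
      (∀ q, F q ≤ g (inner ℝ v q)) ∧ ∀ (x κ : ℝ) (p : ℝ → Plane), 0 < κ →
        (∀ t, inner ℝ v (p t) = x + κ * t) → Tendsto (fun t => F (p t)) (𝓝[>] 0) (𝓝 (g x)) := by
  have hd : ∀ x : ℝ, inner ℝ v (x • d) = x := fun x => by rw [real_inner_smul_right, hvd, mul_one]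
  set G : ℝ → ℝ := fun x => F (x • d) with hG
  have hGm : Monotone G := fun x y hxy => by
    rcases hxy.eq_or_lt with rfl | hlt
    · exact le_rfl
    · exact hF _ _ (by rwa [hd, hd])
  have h1 : ∀ q x, x < inner ℝ v q → Function.rightLim G x ≤ F q := fun q x hx => by
    obtain ⟨y, hy, hy'⟩ := exists_between hx
    exact (hGm.rightLim_le hy).trans (hF _ _ (by rwa [hd]))
  refine ⟨Function.rightLim G, hGm.rightLim, h1, fun q => ?_, fun x κ p hκ hp => ?_⟩
  · refine ge_of_tendsto (hGm.tendsto_rightLim (inner ℝ v q)) ?_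
    filter_upwards [self_mem_nhdsWithin] with x hx
    exact hF _ _ (by rw [hd]; exact hx)
  -- The factor `2` puts the comparison point strictly ahead of `p t`, squeezing `F (p t)` between
  -- the right limit and a value tending to it.
  · have hlim : Tendsto (fun t : ℝ => x + 2 * κ * t) (𝓝[>] 0) (𝓝[>] x) := by
      refine tendsto_nhdsWithin_iff.mpr ⟨?_, ?_⟩
      · have : Continuous fun t : ℝ => x + 2 * κ * t := by fun_prop
        have := this.tendsto 0
        rw [mul_zero, add_zero] at this
        exact this.mono_left nhdsWithin_le_nhds
      · filter_upwards [self_mem_nhdsWithin] with t ht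
        have : 0 < 2 * κ * t := mul_pos (by positivity) ht
        exact Set.mem_Ioi.mpr (by linarith)
    refine tendsto_of_tendsto_of_tendsto_of_le_of_le' tendsto_const_nhds
      ((hGm.tendsto_rightLim x).comp hlim) ?_ ?_
    · filter_upwards [self_mem_nhdsWithin] with t ht
      have : 0 < κ * t := mul_pos hκ ht
      exact h1 _ _ (by rw [hp]; linarith)
    · filter_upwards [self_mem_nhdsWithin] with t ht
      have : 0 < κ * t := mul_pos hκ ht
      exact hF _ _ (by rw [hp, hd]; linarith)

/-- Monotone solutions of Pexider's functional equation are affine. -/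
theorem Monotone.exists_eq_mul_add_of_pexider {g₁ g₂ g₃ : ℝ → ℝ} (hg₃ : Monotone g₃)
    (h : ∀ x y, g₁ x + g₂ y = g₃ (x + y)) : ∃ k, ∀ x, g₃ x = k * x + g₃ 0 := by
  set f : ℝ →+ ℝ := AddMonoidHom.mk' (fun x => g₃ x - g₃ 0) (fun x y => by
    have h1 := h x y
    have h2 := h x 0
    have h3 := h 0 y
    have h4 := h 0 0
    simp only [add_zero, zero_add] at h2 h3 h4
    linarith) with hf
  have hmeas : Measurable f := (hg₃.measurable).sub_const _
  have hcont : Continuous f := MeasureTheory.Measure.AddMonoidHom.continuous_of_measurable f hmeas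
  refine ⟨f 1, fun x => ?_⟩
  have h1 := (f.toRealLinearMap hcont).map_smul x 1
  simp only [smul_eq_mul, mul_one, AddMonoidHom.coe_toRealLinearMap] at h1
  have h2 : f x = g₃ x - g₃ 0 := rfl
  linarith

/-- By Lagrange's identity the squares of the inner product and the determinant add up to `1`; a
zero determinant is equality in Cauchy–Schwarz. -/
theorem det_ne_zero_of_ne_of_ne_neg {u₁ u₂ : Plane} (h₁ : ‖u₁‖ = 1) (h₂ : ‖u₂‖ = 1)
    (hne : u₁ ≠ u₂) (hne' : u₁ ≠ -u₂) : u₁ 0 * u₂ 1 - u₁ 1 * u₂ 0 ≠ 0 := by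
  intro h0
  have e1 : u₁ 0 ^ 2 + u₁ 1 ^ 2 = 1 := by
    have := EuclideanSpace.real_norm_sq_eq u₁
    rw [h₁, Fin.sum_univ_two] at this
    linarith
  have e2 : u₂ 0 ^ 2 + u₂ 1 ^ 2 = 1 := by
    have := EuclideanSpace.real_norm_sq_eq u₂
    rw [h₂, Fin.sum_univ_two] at this
    linarith
  have e3 : inner ℝ u₁ u₂ = u₁ 0 * u₂ 0 + u₁ 1 * u₂ 1 := by
    simp [PiLp.inner_apply, Fin.sum_univ_two, mul_comm]
  have e4 : (inner ℝ u₁ u₂ : ℝ) ^ 2 = 1 := by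
    rw [e3]
    linear_combination (u₂ 0 ^ 2 + u₂ 1 ^ 2) * e1 + e2 - (u₁ 0 * u₂ 1 - u₁ 1 * u₂ 0) * h0
  rcases eq_or_eq_neg_of_sq_eq_sq _ _ (e4.trans (one_pow 2).symm) with h | h
  · exact hne ((inner_eq_one_iff_of_norm_eq_one h₁ h₂).mp h)
  · refine hne' ((inner_eq_one_iff_of_norm_eq_one (𝕜 := ℝ) h₁ (by rwa [norm_neg])).mp ?_)
    rw [inner_neg_right, h, neg_neg]

/-- A map of the plane that is affine in two coordinates and maps points of `A` to `B` and other
points outside the interior of `B` is an affine equivalence of `A` and `B`. -/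
theorem affineEquivalent_of_forall_eq {A B : Set Plane} (hA : IsNormalizedDisk A)
    (hB : IsNormalizedDisk B) {φ : Plane → Plane} (f : Plane ≃ᵃ[ℝ] Plane) (hf : ∀ p, φ p = f p)
    (hmem : ∀ p ∈ interior A, φ p ∈ B) (hnot : ∀ p, p ∉ A → φ p ∉ interior B) :
    AffineEquivalent A B := by
  have hcont : Continuous f := f.toAffineMap.continuous_of_finiteDimensional
  have hcl : ∀ C : Set Plane, IsNormalizedDisk C → C ⊆ closure (interior C) := fun C hC => by
    rw [hC.convex.closure_interior_eq_closure_of_nonempty_interior ⟨0, hC.zero_mem_interior⟩]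
    exact subset_closure
  refine ⟨f, Set.Subset.antisymm ?_ ?_⟩
  · rintro _ ⟨x, hx, rfl⟩
    have : closure (interior A) ⊆ f ⁻¹' B :=
      closure_minimal (fun y hy => (hf y).subst (motive := (· ∈ B)) (hmem y hy)) (hB.isCompact.isClosed.preimage hcont)
    exact this (hcl A hA hx)
  · refine (hcl B hB).trans (closure_minimal (fun y hy => ?_) (hA.isCompact.image hcont).isClosed)
    obtain ⟨x, rfl⟩ := f.surjective y
    by_contra hx
    exact hnot x (fun hxA => hx ⟨x, hxA, rfl⟩) (hf x ▸ hy)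

theorem IsLimitMap.affineEquivalent {A B D : Set Plane} {φ : Plane → Plane}
    (h : IsLimitMap A B D φ) (hA : IsNormalizedDisk A) (hB : IsNormalizedDisk B) {v₁ v₂ : Plane}
    (hv₁ : v₁ ∈ D) (hv₂ : v₂ ∈ D) (hv₃ : v₁ + v₂ ∈ D)
    (hdet : v₁ 0 * v₂ 1 - v₁ 1 * v₂ 0 ≠ 0) : AffineEquivalent A B := by
  obtain ⟨ρ, hρ, hBρ⟩ := hB.exists_ball_subset
  obtain ⟨d₁, d₂, h11, h21, h12, h22, hexp⟩ := exists_dual_basis hdet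
  obtain ⟨u₁, hu₁, hm₁, c₁, hr₁, hl₁⟩ := h.exists_normal v₁ hv₁
  obtain ⟨u₂, hu₂, hm₂, c₂, hr₂, hl₂⟩ := h.exists_normal v₂ hv₂
  obtain ⟨u₃, hu₃, hm₃, c₃, hr₃, hl₃⟩ := h.exists_normal (v₁ + v₂) hv₃
  -- The image of `B` in direction `u` has positive length, containing `0` and `(ρ / 2) • u`. Far
  -- apart points are thus strictly ordered, which rules out degenerate limits.
  have hstrict : ∀ {u v : Plane} {c : ℝ}, ‖u‖ = 1 →
      (∀ p, c < inner ℝ v p → ∀ b ∈ B, (inner ℝ u b : ℝ) ≤ inner ℝ u (φ p)) →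
      (∀ p, inner ℝ v p < -c → ∀ b ∈ B, (inner ℝ u (φ p) : ℝ) ≤ inner ℝ u b) → ∀ p q,
      inner ℝ v p < -c → c < inner ℝ v q → (inner ℝ u (φ p) : ℝ) < inner ℝ u (φ q) := by
    intro u v c hu hr hl p q hp hq
    have h1 := hl p hp 0 hB.zero_mem
    have h2 := hr q hq ((ρ / 2) • u) (hBρ _ (by
      rw [norm_smul, hu, mul_one, Real.norm_of_nonneg (by positivity)]; linarith))
    rw [inner_zero_right] at h1
    rw [real_inner_smul_right, real_inner_self_eq_norm_sq, hu] at h2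
    linarith
  have hin₁ : ∀ x y : ℝ, inner ℝ v₁ (x • d₁ + y • d₂) = x := fun x y => by
    rw [inner_add_right, real_inner_smul_right, real_inner_smul_right, h11, h12]; ring
  have hin₂ : ∀ x y : ℝ, inner ℝ v₂ (x • d₁ + y • d₂) = y := fun x y => by
    rw [inner_add_right, real_inner_smul_right, real_inner_smul_right, h21, h22]; ring
  have hin₃ : ∀ x y : ℝ, inner ℝ (v₁ + v₂) (x • d₁ + y • d₂) = x + y := fun x y => by
    rw [inner_add_left, hin₁, hin₂]
  have habs : ∀ c : ℝ, -(|c| + 1) < -c ∧ c < |c| + 1 := fun c => by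
    constructor <;> linarith [le_abs_self c]
  have hlt₁ : ∀ y y' : ℝ, (inner ℝ u₁ (φ ((-(|c₁| + 1)) • d₁ + y • d₂)) : ℝ) <
      inner ℝ u₁ (φ ((|c₁| + 1) • d₁ + y' • d₂)) := fun y y' =>
    hstrict hu₁ hr₁ hl₁ _ _ (by rw [hin₁]; exact (habs _).1) (by rw [hin₁]; exact (habs _).2)
  -- If `u₁ = ± u₂`, points far apart along `v₁` can be given second coordinates that demand the
  -- reverse order.
  have hudet : u₁ 0 * u₂ 1 - u₁ 1 * u₂ 0 ≠ 0 := by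
    refine det_ne_zero_of_ne_of_ne_neg hu₁ hu₂ ?_ ?_
    · rintro rfl
      have h1 := hlt₁ 1 0
      have h2 := hm₂ ((|c₁| + 1) • d₁ + (0 : ℝ) • d₂) ((-(|c₁| + 1)) • d₁ + (1 : ℝ) • d₂)
        (by rw [hin₂, hin₂]; exact one_pos)
      linarith
    · rintro rfl
      have h1 := hlt₁ 0 1
      have h2 := hm₂ ((-(|c₁| + 1)) • d₁ + (0 : ℝ) • d₂) ((|c₁| + 1) • d₁ + (1 : ℝ) • d₂)
        (by rw [hin₂, hin₂]; exact one_pos)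
      rw [inner_neg_left, inner_neg_left] at h1
      linarith
  obtain ⟨e₁, e₂, k11, k21, k12, k22, hexp'⟩ := exists_dual_basis hudet
  have hu₃' : ∀ x, inner ℝ u₃ x = inner ℝ u₃ e₁ * inner ℝ u₁ x + inner ℝ u₃ e₂ * inner ℝ u₂ x := by
    intro x
    conv_lhs => rw [hexp' x]
    rw [inner_add_right, real_inner_smul_right, real_inner_smul_right]
    ring
  set α : ℝ := inner ℝ u₃ e₁ with hα
  set β : ℝ := inner ℝ u₃ e₂ with hβ
  obtain ⟨g₁, -, hlow₁, hup₁, hlim₁⟩ := exists_monotone_of_inner_lt h11 hm₁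
  obtain ⟨g₂, -, hlow₂, hup₂, hlim₂⟩ := exists_monotone_of_inner_lt h22 hm₂
  obtain ⟨g₃, hg₃, hlow₃, hup₃, hlim₃⟩ := exists_monotone_of_inner_lt
    (show inner ℝ (v₁ + v₂) d₁ = 1 by rw [inner_add_left, h11, h21, add_zero]) hm₃
  -- Along the diagonal path all three coordinates increase, so the relation `u₃ = α u₁ + β u₂`
  -- passes to the right limits simultaneously.
  have hpex : ∀ x y, α * g₁ x + β * g₂ y = g₃ (x + y) := by
    intro x y
    have l1 := hlim₁ x 1 (fun t => (x + t) • d₁ + (y + t) • d₂) one_pos fun t => by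
      rw [hin₁, one_mul]
    have l2 := hlim₂ y 1 (fun t => (x + t) • d₁ + (y + t) • d₂) one_pos fun t => by
      rw [hin₂, one_mul]
    have l3 := hlim₃ (x + y) 2 (fun t => (x + t) • d₁ + (y + t) • d₂) two_pos fun t => by
      rw [hin₃]; ring
    refine tendsto_nhds_unique ((l1.const_mul α).add (l2.const_mul β)) (l3.congr fun t => ?_)
    exact hu₃' _
  obtain ⟨k, hk⟩ := hg₃.exists_eq_mul_add_of_pexider
    (g₁ := fun x => α * g₁ x) (g₂ := fun y => β * g₂ y) hpex
  have hk0 : k ≠ 0 := by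
    rintro rfl
    have hconst : ∀ q, inner ℝ u₃ (φ q) = g₃ 0 := fun q => by
      refine le_antisymm ?_ ?_
      · have := hup₃ q
        rw [hk] at this
        linarith
      · have := hlow₃ q (inner ℝ (v₁ + v₂) q - 1) (by linarith)
        rw [hk] at this
        linarith
    have := hstrict hu₃ hr₃ hl₃ ((-(|c₃| + 1)) • d₁ + (0 : ℝ) • d₂) ((|c₃| + 1) • d₁ + (0 : ℝ) • d₂)
      (by rw [hin₃, add_zero]; exact (habs _).1) (by rw [hin₃, add_zero]; exact (habs _).2)
    rw [hconst, hconst] at this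
    exact lt_irrefl _ this
  have haff : ∀ {a : ℝ} {g : ℝ → ℝ} {v u : Plane}, (∀ x, a * g x = k * x + a * g 0) →
      (∀ q x, x < inner ℝ v q → g x ≤ inner ℝ u (φ q)) →
      (∀ q, inner ℝ u (φ q) ≤ g (inner ℝ v q)) →
      ∃ s : ℝ, s ≠ 0 ∧ ∀ q, inner ℝ u (φ q) = s * inner ℝ v q + g 0 := by
    intro a g v u hg hlow hup
    have ha : a ≠ 0 := by
      rintro rfl
      have := hg 1
      simp only [zero_mul, mul_one, add_zero] at this
      exact hk0 this.symm
    have hg' : ∀ x, g x = k / a * x + g 0 := fun x => by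
      have := hg x
      field_simp
      linarith
    refine ⟨k / a, div_ne_zero hk0 ha, fun q => le_antisymm ?_ ?_⟩
    · rw [← hg']; exact hup q
    -- The lower bound holds only for `x` strictly below the coordinate; continuity of the affine
    -- `g` closes the gap left by possible jumps.
    · have hc : Continuous fun x : ℝ => k / a * x + g 0 := by fun_prop
      refine le_of_tendsto ((hc.tendsto (inner ℝ v q)).mono_left
        (nhdsWithin_le_nhds (s := Set.Iio (inner ℝ v q)))) ?_
      filter_upwards [self_mem_nhdsWithin] with x hx
      rw [← hg']
      exact hlow q x hx
  obtain ⟨s₁, hs₁, hF₁⟩ := haff (a := α) (fun x => by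
    have a1 := hpex x 0
    have a2 := hpex 0 0
    have a3 := hk x
    simp only [add_zero] at a1 a2
    linarith) hlow₁ hup₁
  obtain ⟨s₂, hs₂, hF₂⟩ := haff (a := β) (fun x => by
    have a1 := hpex 0 x
    have a2 := hpex 0 0
    have a3 := hk x
    simp only [zero_add] at a1 a2
    linarith) hlow₂ hup₂
  let T : Plane →ₗ[ℝ] Plane :=
    (s₁ • (innerₗ Plane v₁)).smulRight e₁ + (s₂ • (innerₗ Plane v₂)).smulRight e₂
  have hT : ∀ q, T q = (s₁ * inner ℝ v₁ q) • e₁ + (s₂ * inner ℝ v₂ q) • e₂ := fun q => rfl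
  have hTinj : Function.Injective T := by
    rw [injective_iff_map_eq_zero]
    intro q hq
    rw [hT] at hq
    have q1 := congrArg (fun x => (inner ℝ u₁ x : ℝ)) hq
    have q2 := congrArg (fun x => (inner ℝ u₂ x : ℝ)) hq
    simp only [inner_add_right, real_inner_smul_right, k11, k12, k21, k22, inner_zero_right, mul_one,
      mul_zero, add_zero, zero_add, mul_eq_zero, hs₁, hs₂, false_or] at q1 q2
    rw [hexp q, q1, q2, zero_smul, zero_smul, add_zero]
  refine affineEquivalent_of_forall_eq hA hB
    ((LinearEquiv.ofInjectiveEndo T hTinj).toAffineEquiv.trans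
      (AffineEquiv.constVAdd ℝ Plane (g₁ 0 • e₁ + g₂ 0 • e₂))) (fun q => ?_) h.mem h.notMem
  show φ q = (g₁ 0 • e₁ + g₂ 0 • e₂) + T q
  rw [hT, hexp' (φ q), hF₁, hF₂, add_smul, add_smul]
  abel

/-! ### Conclusion -/

theorem affineEquivalent_of_homGraphs_subset {A B : Set Plane} (hA : IsSmoothConvexDisk A)
    (hB : IsSmoothConvexDisk B) (hAB : homGraphs A ⊆ homGraphs B) : AffineEquivalent A B := by
  obtain ⟨a, ha⟩ := hA.nonempty_interior
  obtain ⟨b, hb⟩ := hB.nonempty_interior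
  have hA' := hA.isNormalizedDisk_translate ha
  have hB' := hB.isNormalizedDisk_translate hb
  have eA := affineEquivalent_translate A a
  have eB := affineEquivalent_translate B b
  obtain ⟨D, U, ψ, hψ, v₁, hv₁, v₂, hv₂, hv₃, hdet⟩ := exists_isLimitRealization hA' hB'
    (eA.symm.homGraphs_subset.trans (hAB.trans eB.homGraphs_subset))
  obtain ⟨φ, hφ⟩ := hψ.exists_isLimitMap hA' hB' hv₁ hv₂ hdet
  exact eA.trans ((hφ.affineEquivalent hA' hB' hv₁ hv₂ hv₃ hdet).trans eB.symm)

theorem theorem1 (A B : Set Plane) (hA : IsSmoothConvexDisk A) (hB : IsSmoothConvexDisk B) :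
    (homGraphs A = homGraphs B ↔ AffineEquivalent A B) ∧
    (¬ AffineEquivalent A B →
      ¬ homGraphs A ⊆ homGraphs B ∧ ¬ homGraphs B ⊆ homGraphs A) := by
  refine ⟨⟨fun h => affineEquivalent_of_homGraphs_subset hA hB h.subset, fun h =>
    Set.Subset.antisymm h.homGraphs_subset h.symm.homGraphs_subset⟩, fun h => ⟨fun hs => ?_,
    fun hs => ?_⟩⟩
  · exact h (affineEquivalent_of_homGraphs_subset hA hB hs)
  · exact h (affineEquivalent_of_homGraphs_subset hB hA hs).symm
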